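/- Let $k$ be a field of characteristic $0$ and let $\mathfrak g$ be a finite-dimensional Lie algebra over $k$ with basis $(e_i)$ and dual basis $(\varepsilon^i)$ of $\mathfrak g^*$. Write $\lambda=\sum_i\lambda_i\varepsilon^i$ for the generic point of $\mathfrak g^*$, so that the completed symmetric algebra $\widehat S(\mathfrak g)$ is $k[[\lambda_i]]$; a formal function on $\mathfrak g^*$ with values in $V$ is a formal power series in the $\lambda_i$ with coefficients in $V$. Let $G$ be the formal group with Lie algebra $\mathfrak g$, and let $\mathrm{Map}_0(\mathfrak g^*,G)$ be the set of formal maps $g:\mathfrak g^*\to G$ with $g(0)=1$, that is, the set of all $g(\lambda)=e^{x(\lambda)}\in U(\mathfrak g)[[\lambda_i]]$, where $x$ is a formal function on $\mathfrak g^*$ with values in $\mathfrak g\subset U(\mathfrak g)$ and $x(0)=0$. Let $\mathrm{Ad}^*$ be the left coadjoint action, $\langle \mathrm{Ad}^*(h)\xi,v\rangle=\langle \xi,\mathrm{Ad}(h^{-1})v\rangle$. Then $\mathrm{Map}_0(\mathfrak g^*,G)$ is a group under $$(g_1*g_2)(\lambda)=g_2\big(\mathrm{Ad}^*(g_1(\lambda))\lambda\big)\,g_1(\lambda),$$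 and the set $\mathrm{Map}_0^{ham}(\mathfrak g^*,G)$ of all $g\in \mathrm{Map}_0(\mathfrak g^*,G)$ such that $$g_1^{-1}d_2(g_1)(\lambda)-g_2^{-1}d_1(g_2)(\lambda)-\big\langle \mathrm{id}\otimes\mathrm{id}\otimes\lambda,\,[g_1^{-1}d_3(g_1)(\lambda),g_2^{-1}d_3(g_2)(\lambda)]\big\rangle=0$$ is a subgroup of it. Explicitly, with $A_i=g^{-1}\partial_{\varepsilon^i}g$, where $\partial_{\xi}g(\lambda)=\frac{d}{d\varepsilon}\big|_{\varepsilon=0}g(\lambda+\varepsilon\xi)$, the condition is $$\sum_i A_i\otimes e_i-\sum_i e_i\otimes A_i-\sum_{i,j}\langle\lambda,[e_i,e_j]\rangle\,A_i\otimes A_j=0,$$ an identity of formal functions on $\mathfrak g^*$ with values in $\mathfrak g\otimes\mathfrak g\subset U(\mathfrak g)\otimes U(\mathfrak g)$. -/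

import Mathlib

open scoped TensorProduct

noncomputable section

namespace FormalMaps

/-! ### Formal power series on `𝔤*` with values in a vector space or an algebra

`𝔤` is a Lie algebra over `k` with a finite basis `b = (e_i)`, and `(ε^i)` is the dual basis of `𝔤*`.
A point of `𝔤*` is written `lam = ∑ i, lam_i ε^i`, so `lam_i = ⟨lam, e_i⟩` and the completed symmetric
algebra of `𝔤` is `k⟦lam_i⟧ = MvPowerSeries I k`.  Formal functions on `𝔤*` with values in `V` are
`MvPowerSeries I V`; for an algebra `V` they are multiplied with central variables `lam_i`. -/

/-- The partial derivative `∂_{ε^i} f (lam) = (d/dε) f (lam + ε ε^i)` at `ε = 0`, that is `∂f/∂lam_i`,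
of a formal function with values in an additive group `V`. -/
def partialDeriv {I V : Type*} [AddCommMonoid V] (i : I) (f : MvPowerSeries I V) :
    MvPowerSeries I V :=
  fun d => (d i + 1) • f (d + Finsupp.single i 1)

/-- The exponential `∑ n, x ^ n / n!` of a formal function `x` with values in a `k`-algebra, meant for
`x` with zero constant term (each coefficient is then a finite sum). -/
def formalExp (k : Type*) {I A : Type*} [Field k] [Ring A] [Algebra k A] (x : MvPowerSeries I A) :
    MvPowerSeries I A :=
  fun d => ∑ᶠ n : ℕ, ((n.factorial : k)⁻¹) • MvPowerSeries.coeff d (x ^ n)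

/-- The composite `f (θ (lam))` of a formal function `f` with a formal map `θ : 𝔤* → 𝔤*`, given by its
coordinates `θ_j ∈ k⟦lam_i⟧`; meant for `θ` with `θ (0) = 0` (each coefficient is then a
finite sum). -/
def compose {k I V : Type*} [Field k] [Fintype I] [AddCommMonoid V] [Module k V]
    (f : MvPowerSeries I V) (θ : I → MvPowerSeries I k) : MvPowerSeries I V :=
  fun d => ∑ᶠ e : I →₀ ℕ, MvPowerSeries.coeff d (∏ j, θ j ^ e j) • f e

variable (k 𝔤 I : Type*) [Field k] [LieRing 𝔤] [LieAlgebra k 𝔤]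

/-- The space of formal maps `g : 𝔤* → G` with `g (0) = 1`, where `G` is the formal group with
Lie algebra `𝔤`: the elements `exp x` of `U(𝔤)⟦lam_i⟧`, where all coefficients of `x` lie in
`𝔤 ⊆ U(𝔤)` and the constant term of `x` is zero. -/
def map0 : Set (MvPowerSeries I (UniversalEnvelopingAlgebra k 𝔤)) :=
  {g | ∃ x : MvPowerSeries I (UniversalEnvelopingAlgebra k 𝔤),
      (∀ d, MvPowerSeries.coeff d x ∈ Set.range (UniversalEnvelopingAlgebra.ι k (L := 𝔤))) ∧
      MvPowerSeries.constantCoeff x = 0 ∧ g = formalExp k x}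

variable {k 𝔤 I}

/-- The `m`-th coordinate `y_m` of a formal function `y = ∑ m, y_m e_m` with values in `𝔤`. -/
def coordinate (b : Module.Basis I k 𝔤) (m : I) (y : MvPowerSeries I 𝔤) : MvPowerSeries I k :=
  fun d => b.repr (y d) m

/-- The pairing `⟨lam, y (lam)⟩ = ∑ m, y_m (lam) lam_m` of the generic point `lam` of `𝔤*` with a formal
function `y = ∑ m, y_m e_m` with values in `𝔤`. -/
def pairing [Fintype I] (b : Module.Basis I k 𝔤) (y : MvPowerSeries I 𝔤) : MvPowerSeries I k :=
  ∑ m : I, coordinate b m y * MvPowerSeries.X m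

/-- The adjoint representation of `U(𝔤)` on `𝔤`, extending `ad : 𝔤 → End 𝔤`. -/
def adjointRep (k 𝔤 : Type*) [Field k] [LieRing 𝔤] [LieAlgebra k 𝔤] :
    UniversalEnvelopingAlgebra k 𝔤 →ₐ[k] Module.End k 𝔤 :=
  UniversalEnvelopingAlgebra.lift k (LieAlgebra.ad k 𝔤)

/-- The formal function `Ad (g (lam)) v` with values in `𝔤`, for a fixed vector `v` of `𝔤`. -/
def Ad (g : MvPowerSeries I (UniversalEnvelopingAlgebra k 𝔤)) (v : 𝔤) : MvPowerSeries I 𝔤 :=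
  fun d => adjointRep k 𝔤 (MvPowerSeries.coeff d g) v

/-- The formal map `lam ↦ Ad* (g (lam)) lam` from `𝔤*` to itself, for the (left) coadjoint action
`⟨Ad* (h) ξ, v⟩ = ⟨ξ, Ad (h⁻¹) v⟩`; its `j`-th coordinate is
`⟨Ad* (g (lam)) lam, e_j⟩ = ⟨lam, Ad (g (lam)⁻¹) e_j⟩`. -/
def coadjointMap [Fintype I] (b : Module.Basis I k 𝔤)
    (g : MvPowerSeries I (UniversalEnvelopingAlgebra k 𝔤)) : I → MvPowerSeries I k :=
  fun j => pairing b (Ad (Ring.inverse g) (b j))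

/-- The product `(g₁ * g₂) (lam) = g₂ (Ad* (g₁ (lam)) lam) g₁ (lam)`. -/
def mapMul [Fintype I] (b : Module.Basis I k 𝔤)
    (g₁ g₂ : MvPowerSeries I (UniversalEnvelopingAlgebra k 𝔤)) :
    MvPowerSeries I (UniversalEnvelopingAlgebra k 𝔤) :=
  compose g₂ (coadjointMap b g₁) * g₁

/-- The left logarithmic derivative `g⁻¹ ∂_{ε^i} g`. -/
def leftLogDeriv (g : MvPowerSeries I (UniversalEnvelopingAlgebra k 𝔤)) (i : I) :
    MvPowerSeries I (UniversalEnvelopingAlgebra k 𝔤) :=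
  Ring.inverse g * partialDeriv i g

/-- `u ↦ u ⊗ 1` on formal functions with values in `U(𝔤)`. -/
def inFst : MvPowerSeries I (UniversalEnvelopingAlgebra k 𝔤) →+*
    MvPowerSeries I (UniversalEnvelopingAlgebra k 𝔤 ⊗[k] UniversalEnvelopingAlgebra k 𝔤) :=
  MvPowerSeries.map (Algebra.TensorProduct.includeLeft (R := k) (S := k)
    (A := UniversalEnvelopingAlgebra k 𝔤) (B := UniversalEnvelopingAlgebra k 𝔤)).toRingHom

/-- `u ↦ 1 ⊗ u` on formal functions with values in `U(𝔤)`. -/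
def inSnd : MvPowerSeries I (UniversalEnvelopingAlgebra k 𝔤) →+*
    MvPowerSeries I (UniversalEnvelopingAlgebra k 𝔤 ⊗[k] UniversalEnvelopingAlgebra k 𝔤) :=
  MvPowerSeries.map (Algebra.TensorProduct.includeRight (R := k)
    (A := UniversalEnvelopingAlgebra k 𝔤) (B := UniversalEnvelopingAlgebra k 𝔤)).toRingHom

/-- A vector of `𝔤`, as a constant formal function with values in `U(𝔤)`. -/
def constVec (v : 𝔤) : MvPowerSeries I (UniversalEnvelopingAlgebra k 𝔤) :=
  MvPowerSeries.C (UniversalEnvelopingAlgebra.ι k v)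

/-- `g₁⁻¹ d₂(g₁) = ∑ i, g⁻¹ ∂_{ε^i} g ⊗ e_i`. -/
def d₂g₁ [Fintype I] (b : Module.Basis I k 𝔤)
    (g : MvPowerSeries I (UniversalEnvelopingAlgebra k 𝔤)) :
    MvPowerSeries I (UniversalEnvelopingAlgebra k 𝔤 ⊗[k] UniversalEnvelopingAlgebra k 𝔤) :=
  ∑ i : I, inFst (leftLogDeriv g i) * inSnd (constVec (b i))

/-- `g₂⁻¹ d₁(g₂) = ∑ i, e_i ⊗ g⁻¹ ∂_{ε^i} g`. -/
def d₁g₂ [Fintype I] (b : Module.Basis I k 𝔤)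
    (g : MvPowerSeries I (UniversalEnvelopingAlgebra k 𝔤)) :
    MvPowerSeries I (UniversalEnvelopingAlgebra k 𝔤 ⊗[k] UniversalEnvelopingAlgebra k 𝔤) :=
  ∑ i : I, inFst (constVec (b i)) * inSnd (leftLogDeriv g i)

/-- `⟨id ⊗ id ⊗ lam, [g₁⁻¹ d₃(g₁), g₂⁻¹ d₃(g₂)]⟩
  = ∑ i j, ⟨lam, [e_i, e_j]⟩ (g⁻¹ ∂_{ε^i} g ⊗ g⁻¹ ∂_{ε^j} g)`. -/
def bracketTerm [Fintype I] (b : Module.Basis I k 𝔤)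
    (g : MvPowerSeries I (UniversalEnvelopingAlgebra k 𝔤)) :
    MvPowerSeries I (UniversalEnvelopingAlgebra k 𝔤 ⊗[k] UniversalEnvelopingAlgebra k 𝔤) :=
  ∑ i : I, ∑ j : I, ∑ m : I, b.repr ⁅b i, b j⁆ m •
    (MvPowerSeries.X m * (inFst (leftLogDeriv g i) * inSnd (leftLogDeriv g j)))

/-- The Hamiltonian condition: the graph of `g` is Lagrangian,
`g₁⁻¹ d₂(g₁) - g₂⁻¹ d₁(g₂) - ⟨id ⊗ id ⊗ lam, [g₁⁻¹ d₃(g₁), g₂⁻¹ d₃(g₂)]⟩ = 0`.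
All terms take values in `𝔤 ⊗ 𝔤 ⊆ U(𝔤) ⊗ U(𝔤)`, and the identity is written there. -/
def IsHamiltonian [Fintype I] (b : Module.Basis I k 𝔤)
    (g : MvPowerSeries I (UniversalEnvelopingAlgebra k 𝔤)) : Prop :=
  d₂g₁ b g - d₁g₂ b g - bracketTerm b g = 0

end FormalMaps

end

/-!
Write `A = U(𝔤)⟦lam_i⟧` and `R = k⟦lam_i⟧`, a central subring of `A`.

**Formal maps into the group.** An element `g` of `A` with `g (0) = 1` is the exponential of a
`𝔤`-valued series if and only if all `g⁻¹ ∂_i g` are `𝔤`-valued (`mem_map0_iff`). One direction is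
`D (exp x) = exp x * ∑ n, (-ad x) ^ n (D x) / (n + 1)!`. For the other, `g = exp x` for some `x` with
values in `U(𝔤)`, and the same formula for the Euler derivation `D` shows, degree by degree, that the
coefficients of `x` lie in `𝔤`. This replaces the Baker–Campbell–Hausdorff formula: with
`g⁻¹ ∂_i g = ∑ m, a_{im} e_m` (`HasLogDeriv b g a`), closure of `map0` under products, inverses and
substitutions is the Leibniz rule and the chain rule, once it is known that conjugation by `g` acts on
`𝔤` through the matrix of `Ad g` (`constVec_mul`). This holds since `g (Ad (g⁻¹) v) g⁻¹` has
vanishing derivatives and the value `v` at `0`.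

**The group.** Associativity is `θ_{g * h} = θ_h ∘ θ_g` for the coadjoint substitutions
`θ_g (lam) = Ad* (g (lam)) lam` (`coadjointMap_mapMul`). As `θ_g` is tangent to the
identity, there is `ψ` with `ψ ∘ θ_g = id`, and `g⁻¹ ∘ ψ` is a right inverse of `g`.

**Hamiltonian maps.** Let `π_{ij} = ⟨lam, [e_i, e_j]⟩`. The Hamiltonian condition says that the matrix
`Z(a) = aᵀ - a - aᵀ π a`, read as an element of `𝔤 ⊗ 𝔤`, vanishes in `U(𝔤) ⊗ U(𝔤)`
(`isHamiltonian_iff`). With `M` the matrix of `Ad (g⁻¹)`, the Jacobian matrix of `θ_g` is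
`(1 - a π) M`, and `Mᵀ π M = π ∘ θ_g`. Hence `g * h` has the matrix `a + (1 - a π) β`, where
`β = M (a' ∘ θ_g) Mᵀ` for the matrix `a'` of `h`, and
`Z(a + (1 - a π) β) = Z(a) + Z(β) + βᵀ π Z(a) - Z(a) π β - βᵀ π Z(a) π β`
(`hamMatrix_add_mul`), while `Z(β) = M (Z(a') ∘ θ_g) Mᵀ`. So if `g` is Hamiltonian, then `g * h` is
Hamiltonian if and only if `h` is (`isHamiltonian_mapMul_iff`), which makes the Hamiltonian maps a
subgroup.

The injectivity of `𝔤 → U(𝔤)` is not needed: its kernel is central in `𝔤`, so that contraction with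
`π` kills it (`vec_mul_kks_eq_zero`).
-/

noncomputable section

namespace FormalMaps

/-! ### Order of vanishing -/

section Calculus

open MvPowerSeries Finsupp

variable {I A : Type*} [Ring A]

/-- All coefficients of `f` of total degree less than `n` vanish. -/
def OrdGE (n : ℕ) (f : MvPowerSeries I A) : Prop :=
  ∀ d : I →₀ ℕ, d.degree < n → coeff d f = 0

namespace OrdGE

variable {m n : ℕ} {f g : MvPowerSeries I A}

theorem zero_order (f : MvPowerSeries I A) : OrdGE 0 f := fun _ h => absurd h (Nat.not_lt_zero _)

theorem zero (n : ℕ) : OrdGE n (0 : MvPowerSeries I A) := fun _ _ => by simp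

theorem mono (h : OrdGE n f) (hmn : m ≤ n) : OrdGE m f := fun d hd => h d (hd.trans_le hmn)

theorem add (hf : OrdGE n f) (hg : OrdGE n g) : OrdGE n (f + g) := fun d hd => by
  rw [map_add, hf d hd, hg d hd, add_zero]

theorem neg (hf : OrdGE n f) : OrdGE n (-f) := fun d hd => by
  rw [map_neg, hf d hd, neg_zero]

theorem sub (hf : OrdGE n f) (hg : OrdGE n g) : OrdGE n (f - g) := by
  rw [sub_eq_add_neg]; exact hf.add hg.neg

theorem sum {ι : Type*} {s : Finset ι} {f : ι → MvPowerSeries I A}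
    (h : ∀ i ∈ s, OrdGE n (f i)) : OrdGE n (∑ i ∈ s, f i) := fun d hd => by
  rw [map_sum]; exact Finset.sum_eq_zero fun i hi => h i hi d hd

theorem mul (hf : OrdGE m f) (hg : OrdGE n g) : OrdGE (m + n) (f * g) := fun d hd => by
  classical
  rw [coeff_mul]
  refine Finset.sum_eq_zero fun p hp => ?_
  rw [Finset.HasAntidiagonal.mem_antidiagonal] at hp
  have : p.1.degree + p.2.degree = d.degree := by rw [← hp, map_add]
  rcases lt_or_ge p.1.degree m with h | h
  · rw [hf _ h, zero_mul]
  · rw [hg _ (by omega), mul_zero]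

theorem mul_left (hg : OrdGE n g) : OrdGE n (f * g) := by
  simpa using (zero_order f).mul hg

theorem mul_right (hf : OrdGE n f) : OrdGE n (f * g) := by
  simpa using hf.mul (zero_order g)

theorem pow (hf : OrdGE 1 f) (n : ℕ) : OrdGE n (f ^ n) := by
  induction n with
  | zero => exact zero_order _
  | succ n ih => rw [pow_succ]; exact ih.mul hf

theorem smul {k : Type*} [Semiring k] [Module k A] (c : k) (hf : OrdGE n f) :
    OrdGE n (c • f) := fun d hd => by
  have : coeff d (c • f) = c • coeff d f := rfl
  rw [this, hf d hd, smul_zero]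

theorem one_iff : OrdGE 1 f ↔ constantCoeff f = 0 := by
  constructor
  · intro h
    rw [← coeff_zero_eq_constantCoeff_apply]
    exact h 0 (by simp)
  · intro h d hd
    have : d = 0 := by rw [← degree_eq_zero_iff]; omega
    rw [this, coeff_zero_eq_constantCoeff_apply, h]

theorem eq_zero (h : ∀ n, OrdGE n f) : f = 0 := by
  ext d
  rw [h (d.degree + 1) d (by omega), coeff_zero]

end OrdGE

/-- The contraction principle for the `(lam_i)`-adic topology. -/
theorem exists_fixedPoint_of_contracting (Φ : MvPowerSeries I A → MvPowerSeries I A)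
    (hΦ : ∀ n f g, OrdGE n (f - g) → OrdGE (n + 1) (Φ f - Φ g)) :
    ∃ f, Φ f = f := by
  set s : ℕ → MvPowerSeries I A := fun n => Φ^[n] 0 with hs
  have hs1 : ∀ n, s (n + 1) = Φ (s n) := fun n => Function.iterate_succ_apply' Φ n 0
  have h1 : ∀ n, OrdGE n (s (n + 1) - s n) := by
    intro n
    induction n with
    | zero => exact OrdGE.zero_order _
    | succ n ih =>
      have := hΦ _ _ _ ih
      rwa [← hs1, ← hs1] at this
  have h2 : ∀ n m, OrdGE n (s (n + m) - s n) := by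
    intro n m
    induction m with
    | zero => simpa using OrdGE.zero n
    | succ m ih =>
      have := ((h1 (n + m)).mono (Nat.le_add_right n m)).add ih
      simpa [add_assoc] using this
  let f : MvPowerSeries I A := fun d => coeff d (s (d.degree + 1))
  have h3 : ∀ n, OrdGE n (f - s n) := by
    intro n d hd
    obtain ⟨m, rfl⟩ := Nat.exists_eq_add_of_le (Nat.succ_le_of_lt hd)
    have h := h2 (d.degree + 1) m d (by omega)
    rw [map_sub, sub_eq_zero] at h ⊢
    exact h.symm
  refine ⟨f, sub_eq_zero.1 (OrdGE.eq_zero fun n => ?_)⟩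
  have h4 := (hΦ n _ _ (h3 n)).sub (h3 (n + 1))
  rw [hs1, sub_sub_sub_cancel_right] at h4
  exact h4.mono n.le_succ

/-- Additive maps which are continuous for the `(lam_i)`-adic topology are determined by their values
on monomials. -/
theorem addHom_ext_of_monomial [Finite I] {B : Type*} [Ring B]
    {F G : MvPowerSeries I A →+ MvPowerSeries I B}
    (hF : ∀ n, ∃ N, ∀ f, OrdGE N f → OrdGE n (F f))
    (hG : ∀ n, ∃ N, ∀ f, OrdGE N f → OrdGE n (G f))
    (h : ∀ e u, F (monomial e u) = G (monomial e u)) : F = G := by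
  classical
  refine AddMonoidHom.ext fun f => sub_eq_zero.1 (OrdGE.eq_zero fun n => ?_)
  obtain ⟨N, hN⟩ := hF n
  obtain ⟨N', hN'⟩ := hG n
  set S : Finset (I →₀ ℕ) := (finite_of_degree_le (σ := I) (max N N')).toFinset with hS
  set t : MvPowerSeries I A := ∑ e ∈ S, monomial e (coeff e f) with ht
  have hft : OrdGE (max N N') (f - t) := by
    intro d hd
    rw [map_sub, ht, map_sum, Finset.sum_eq_single d]
    · simp
    · intro e _ hne
      rw [coeff_monomial, if_neg hne.symm]
    · intro hd'
      simp only [hS, Set.Finite.mem_toFinset, Set.mem_ofPred_eq] at hd'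
      omega
  have h1 : F t = G t := by simp only [ht, map_sum, h]
  have h2 : F f - G f = F (f - t) - G (f - t) := by simp only [map_sub, h1]; abel
  rw [h2]
  exact (hN _ (hft.mono (le_max_left _ _))).sub (hN' _ (hft.mono (le_max_right _ _)))

/-! ### Derivations -/

/-- The derivation multiplying the coefficient at `lam ^ d` by `w d`. It is `lam_i ∂_i` for
`w d = d i`, and the Euler derivation for the total degree `w`. -/
def weightDeriv (w : (I →₀ ℕ) →+ ℕ) : MvPowerSeries I A →+ MvPowerSeries I A where
  toFun f := fun d => w d • coeff d f
  map_zero' := by ext d; change w d • coeff d (0 : MvPowerSeries I A) = _; simp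
  map_add' f g := by
    ext d
    change w d • coeff d (f + g) = w d • coeff d f + w d • coeff d g
    simp

theorem coeff_weightDeriv (w : (I →₀ ℕ) →+ ℕ) (f : MvPowerSeries I A) (d : I →₀ ℕ) :
    coeff d (weightDeriv w f) = w d • coeff d f := rfl

theorem weightDeriv_mul (w : (I →₀ ℕ) →+ ℕ) (f g : MvPowerSeries I A) :
    weightDeriv w (f * g) = weightDeriv w f * g + f * weightDeriv w g := by
  classical
  ext d
  rw [coeff_weightDeriv, map_add, coeff_mul, coeff_mul, coeff_mul, Finset.smul_sum,
    ← Finset.sum_add_distrib]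
  refine Finset.sum_congr rfl fun p hp => ?_
  rw [Finset.HasAntidiagonal.mem_antidiagonal] at hp
  rw [← hp, map_add, coeff_weightDeriv, coeff_weightDeriv, add_smul, smul_mul_assoc,
    mul_smul_comm]

theorem OrdGE.weightDeriv {n : ℕ} {f : MvPowerSeries I A} (w : (I →₀ ℕ) →+ ℕ) (hf : OrdGE n f) :
    OrdGE n (weightDeriv w f) := fun d hd => by
  rw [coeff_weightDeriv, hf d hd, smul_zero]

theorem coeff_partialDeriv (i : I) (f : MvPowerSeries I A) (d : I →₀ ℕ) :
    coeff d (partialDeriv i f) = (d i + 1) • coeff (d + single i 1) f := rfl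

/-- Reduces the Leibniz rule for `∂_i` to that of `lam_i ∂_i`, which preserves degrees. -/
theorem X_mul_partialDeriv (i : I) (f : MvPowerSeries I A) :
    X i * partialDeriv i f = weightDeriv (applyAddHom i) f := by
  classical
  ext d
  rw [coeff_weightDeriv, X_def, applyAddHom_apply]
  by_cases h : d i = 0
  · rw [h, zero_smul, coeff_monomial_mul, if_neg]
    intro h'
    have := h' i
    simp at this
    omega
  · obtain ⟨e, rfl⟩ : ∃ e, d = single i 1 + e := by
      refine ⟨d - single i 1, ?_⟩
      rw [add_tsub_cancel_of_le]
      intro j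
      by_cases hj : j = i
      · subst hj; simp; omega
      · simp [Ne.symm hj]
    rw [coeff_add_monomial_mul, one_mul, coeff_partialDeriv, add_comm e]
    simp [add_comm]

theorem X_mul_injective (i : I) : Function.Injective fun f : MvPowerSeries I A => X i * f := by
  intro f g h
  ext d
  have := congrArg (coeff (single i 1 + d)) h
  simpa only [X_def, coeff_add_monomial_mul, one_mul] using this

theorem partialDeriv_add (i : I) (f g : MvPowerSeries I A) :
    partialDeriv i (f + g) = partialDeriv i f + partialDeriv i g := by
  apply X_mul_injective i
  simp only [mul_add, X_mul_partialDeriv, map_add]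

theorem partialDeriv_mul (i : I) (f g : MvPowerSeries I A) :
    partialDeriv i (f * g) = partialDeriv i f * g + f * partialDeriv i g := by
  apply X_mul_injective i
  simp only [mul_add, X_mul_partialDeriv, weightDeriv_mul]
  rw [← mul_assoc, X_mul_partialDeriv, ← mul_assoc, (commute_X f i).eq.symm, mul_assoc,
    X_mul_partialDeriv]

/-- `∂_{ε^i}` as an additive map. -/
def partialDerivHom (i : I) : MvPowerSeries I A →+ MvPowerSeries I A :=
  AddMonoidHom.mk' (partialDeriv i) (partialDeriv_add i)

theorem partialDeriv_sum {ι : Type*} (i : I) (s : Finset ι) (f : ι → MvPowerSeries I A) :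
    partialDeriv i (∑ j ∈ s, f j) = ∑ j ∈ s, partialDeriv i (f j) :=
  map_sum (partialDerivHom i) f s

theorem partialDeriv_C (i : I) (u : A) : partialDeriv i (C u : MvPowerSeries I A) = 0 := by
  classical
  ext d
  rw [coeff_partialDeriv, coeff_C, if_neg, smul_zero, coeff_zero]
  intro h
  have := DFunLike.congr_fun h i
  simp at this

theorem partialDeriv_one (i : I) : partialDeriv i (1 : MvPowerSeries I A) = 0 := by
  rw [← map_one C, partialDeriv_C]

theorem partialDeriv_X_self (i : I) : partialDeriv i (X i : MvPowerSeries I A) = 1 := by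
  classical
  ext d
  rw [coeff_partialDeriv, coeff_X, coeff_one]
  by_cases h : d = 0
  · subst h; simp
  · rw [if_neg h, if_neg, smul_zero]
    simpa using h

theorem partialDeriv_X_of_ne {i j : I} (h : i ≠ j) :
    partialDeriv i (X j : MvPowerSeries I A) = 0 := by
  classical
  ext d
  rw [coeff_partialDeriv, coeff_X, if_neg, smul_zero, coeff_zero]
  intro h'
  have := DFunLike.congr_fun h' i
  simp [h] at this

theorem partialDeriv_map {B : Type*} [Ring B] (φ : A →+* B) (i : I) (f : MvPowerSeries I A) :
    partialDeriv i (map φ f) = map φ (partialDeriv i f) := by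
  ext d
  simp only [coeff_partialDeriv, coeff_map, map_nsmul]

theorem OrdGE.partialDeriv {n : ℕ} {f : MvPowerSeries I A} (i : I) (hf : OrdGE (n + 1) f) :
    OrdGE n (partialDeriv i f) := fun d hd => by
  rw [coeff_partialDeriv, hf _ (by simpa using hd), smul_zero]

theorem eq_of_partialDeriv_eq [IsAddTorsionFree A] {f g : MvPowerSeries I A}
    (h0 : constantCoeff f = constantCoeff g) (h : ∀ i, partialDeriv i f = partialDeriv i g) :
    f = g := by
  classical
  ext d
  by_cases hd : d = 0
  · subst hd; simpa using h0
  · obtain ⟨i, hi⟩ : ∃ i, d i ≠ 0 := by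
      by_contra! h'
      exact hd (Finsupp.ext h')
    have h1 : weightDeriv (applyAddHom i) f = weightDeriv (applyAddHom i) g := by
      rw [← X_mul_partialDeriv, ← X_mul_partialDeriv, h]
    have h2 := congrArg (coeff d) h1
    rw [coeff_weightDeriv, coeff_weightDeriv] at h2
    exact nsmul_right_injective hi h2

end Calculus

/-! ### Composition with a formal map -/

section Composition

open MvPowerSeries Finsupp

variable {k I A : Type*} [Field k] [Ring A] [Algebra k A]

/-- The embedding of the scalar formal functions as central elements. -/
abbrev scal : MvPowerSeries I k →+* MvPowerSeries I A := map (algebraMap k A)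

theorem scal_commute (r : MvPowerSeries I k) (f : MvPowerSeries I A) :
    Commute (scal r) f := by
  classical
  ext d
  rw [coeff_mul, coeff_mul, Finsupp.sum_antidiagonal_swap d fun a b => coeff a f * coeff b (scal r)]
  refine Finset.sum_congr rfl fun p _ => ?_
  simp only [coeff_map, Algebra.commutes]

theorem scal_self (r : MvPowerSeries I k) : (scal r : MvPowerSeries I k) = r := by
  ext d; simp

variable [Fintype I]

/-- `θ ^ e = ∏ j, θ_j ^ e_j`. -/
def monomialAt (θ : I → MvPowerSeries I k) (e : I →₀ ℕ) : MvPowerSeries I k :=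
  ∏ j, θ j ^ e j

theorem monomialAt_zero (θ : I → MvPowerSeries I k) : monomialAt θ 0 = 1 := by
  simp [monomialAt]

theorem monomialAt_add (θ : I → MvPowerSeries I k) (e e' : I →₀ ℕ) :
    monomialAt θ (e + e') = monomialAt θ e * monomialAt θ e' := by
  simp [monomialAt, pow_add, Finset.prod_mul_distrib]

theorem monomialAt_single (θ : I → MvPowerSeries I k) (j : I) :
    monomialAt θ (single j 1) = θ j := by
  classical
  rw [monomialAt, Finset.prod_eq_single j]
  · simp
  · intro i _ hi
    simp [hi.symm]
  · simp

theorem monomialAt_X (e : I →₀ ℕ) : monomialAt (X : I → MvPowerSeries I k) e = monomial e 1 := by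
  rw [monomial_one_eq, Finsupp.prod_fintype _ _ (by simp)]
  rfl

theorem ordGE_monomialAt {θ : I → MvPowerSeries I k} (hθ : ∀ j, constantCoeff (θ j) = 0)
    (e : I →₀ ℕ) : OrdGE e.degree (monomialAt θ e) := by
  induction e using Finsupp.induction_linear with
  | zero => simpa using OrdGE.zero_order _
  | add e e' h h' => rw [monomialAt_add, map_add]; exact h.mul h'
  | single j n =>
    induction n with
    | zero => simpa using OrdGE.zero_order _
    | succ n ih =>
      rw [single_add, monomialAt_add, monomialAt_single, map_add]
      refine ih.mul ?_
      rw [degree_single]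
      exact OrdGE.one_iff.2 (hθ j)

/-- For a substitution without constant term, each coefficient of a composite is a finite sum. -/
theorem coeff_compose {θ : I → MvPowerSeries I k} (hθ : ∀ j, constantCoeff (θ j) = 0)
    (f : MvPowerSeries I A) (d : I →₀ ℕ) :
    coeff d (compose f θ) =
      ∑ e ∈ (finite_of_degree_le (σ := I) d.degree).toFinset,
        coeff d (monomialAt θ e) • coeff e f := by
  refine finsum_eq_sum_of_support_subset _ fun e he => ?_
  simp only [Set.Finite.coe_toFinset, Set.mem_ofPred_eq]
  by_contra! h
  refine he ?_
  change coeff d (monomialAt θ e) • f e = 0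
  rw [ordGE_monomialAt hθ e d h, zero_smul]

/-- Composition with a substitution without constant term, as an additive map. -/
def composeAddHom {θ : I → MvPowerSeries I k} (hθ : ∀ j, constantCoeff (θ j) = 0) :
    MvPowerSeries I A →+ MvPowerSeries I A :=
  AddMonoidHom.mk' (fun f => compose f θ) fun f g => by
    ext d
    simp only [map_add, coeff_compose hθ, smul_add, Finset.sum_add_distrib]

variable {θ ψ : I → MvPowerSeries I k} (hθ : ∀ j, constantCoeff (θ j) = 0)
  (hψ : ∀ j, constantCoeff (ψ j) = 0)

include hθ

theorem OrdGE.compose {n : ℕ} {f : MvPowerSeries I A} (hf : OrdGE n f) :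
    OrdGE n (compose f θ) := fun d hd => by
  rw [coeff_compose hθ]
  refine Finset.sum_eq_zero fun e he => ?_
  simp only [Set.Finite.mem_toFinset, Set.mem_ofPred_eq] at he
  rw [hf e (he.trans_lt hd), smul_zero]

theorem compose_monomial (e : I →₀ ℕ) (u : A) :
    compose (monomial e u) θ = scal (monomialAt θ e) * C u := by
  classical
  ext d
  rw [coeff_compose hθ, coeff_mul_C, coeff_map]
  by_cases h : e.degree ≤ d.degree
  · rw [Finset.sum_eq_single e]
    · rw [coeff_monomial_same, Algebra.smul_def]
    · intro e' _ hne
      rw [coeff_monomial_ne hne, smul_zero]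
    · intro h'
      simp only [Set.Finite.mem_toFinset, Set.mem_ofPred_eq] at h'
      exact absurd h h'
  · rw [ordGE_monomialAt hθ e d (not_le.1 h), map_zero, zero_mul]
    refine Finset.sum_eq_zero fun e' he' => ?_
    simp only [Set.Finite.mem_toFinset, Set.mem_ofPred_eq] at he'
    rw [coeff_monomial_ne (by rintro rfl; exact h he'), smul_zero]

theorem compose_C (u : A) : compose (C u) θ = C u := by
  rw [← monomial_zero_eq_C_apply, compose_monomial hθ, monomialAt_zero, map_one, one_mul,
    monomial_zero_eq_C_apply]

theorem compose_mul (f g : MvPowerSeries I A) :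
    compose (f * g) θ = compose f θ * compose g θ := by
  let T : MvPowerSeries I A →+ MvPowerSeries I A := composeAddHom hθ
  have hT : ∀ n f, OrdGE n f → OrdGE n (T f) := fun n f hf => hf.compose hθ
  -- Both sides are biadditive and continuous: reduce first `g`, then `f`, to monomials.
  have h1 : ∀ (e : I →₀ ℕ) (u : A), T.comp (AddMonoidHom.mulLeft (monomial e u)) =
      (AddMonoidHom.mulLeft (T (monomial e u))).comp T := by
    intro e u
    refine addHom_ext_of_monomial (fun n => ⟨n, fun f hf => hT _ _ hf.mul_left⟩)
      (fun n => ⟨n, fun f hf => (hT _ _ hf).mul_left⟩) fun e' u' => ?_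
    change compose (monomial e u * monomial e' u') θ =
      compose (monomial e u) θ * compose (monomial e' u') θ
    rw [monomial_mul_monomial, compose_monomial hθ, compose_monomial hθ, compose_monomial hθ,
      monomialAt_add, map_mul, map_mul, mul_assoc, mul_assoc, ← mul_assoc (C u),
      (scal_commute (monomialAt θ e') (C u)).eq.symm, mul_assoc]
  have h2 : T.comp (AddMonoidHom.mulRight g) = (AddMonoidHom.mulRight (T g)).comp T :=
    addHom_ext_of_monomial (fun n => ⟨n, fun f hf => hT _ _ hf.mul_right⟩)
      (fun n => ⟨n, fun f hf => (hT _ _ hf).mul_right⟩)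
      fun e u => DFunLike.congr_fun (h1 e u) g
  exact DFunLike.congr_fun h2 f

omit hθ in
/-- Composition with a substitution without constant term, as a ring homomorphism. -/
def composeHom (hθ : ∀ j, constantCoeff (θ j) = 0) : MvPowerSeries I A →+* MvPowerSeries I A where
  __ := composeAddHom hθ
  map_one' := by
    change compose 1 θ = 1
    rw [← map_one C, compose_C hθ]
  map_mul' := compose_mul hθ

omit hθ in
theorem composeHom_apply (hθ : ∀ j, constantCoeff (θ j) = 0) (f : MvPowerSeries I A) :
    composeHom hθ f = compose f θ := rfl

theorem constantCoeff_compose (f : MvPowerSeries I A) :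
    constantCoeff (compose f θ) = constantCoeff f := by
  have h : OrdGE 1 (f - C (constantCoeff f)) := OrdGE.one_iff.2 (by simp)
  have h1 := OrdGE.one_iff.1 (h.compose hθ)
  rw [← composeHom_apply hθ, map_sub, composeHom_apply, composeHom_apply, compose_C hθ, map_sub,
    sub_eq_zero, constantCoeff_C] at h1
  exact h1

theorem compose_X (j : I) : compose (X j : MvPowerSeries I A) θ = scal (θ j) := by
  rw [X_def, compose_monomial hθ, monomialAt_single, map_one, mul_one]

theorem compose_map {B : Type*} [Ring B] [Algebra k B] (φ : A →ₐ[k] B) (f : MvPowerSeries I A) :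
    compose (map (φ : A →+* B) f) θ = map (φ : A →+* B) (compose f θ) := by
  ext d
  simp only [coeff_compose hθ, coeff_map, map_sum, RingHom.coe_coe, map_smul]

theorem compose_scal (r : MvPowerSeries I k) :
    compose (scal r : MvPowerSeries I A) θ = scal (compose r θ) :=
  compose_map hθ (Algebra.ofId k A) r

include hψ

theorem compose_compose (f : MvPowerSeries I A) :
    compose (compose f θ) ψ = compose f fun j => compose (θ j) ψ := by
  have hθψ : ∀ j, constantCoeff (compose (θ j) ψ) = 0 := fun j => by
    rw [constantCoeff_compose hψ, hθ]
  have h : (composeAddHom hψ).comp (composeAddHom hθ) = composeAddHom (A := A) hθψ := by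
    refine addHom_ext_of_monomial (fun n => ⟨n, fun f hf => (hf.compose hθ).compose hψ⟩)
      (fun n => ⟨n, fun f hf => hf.compose hθψ⟩) fun e u => ?_
    change compose (compose (monomial e u) θ) ψ = compose (monomial e u) _
    rw [compose_monomial hθ, compose_monomial hθψ, compose_mul hψ, compose_C hψ,
      compose_scal hψ]
    congr 2
    simp only [monomialAt, ← composeHom_apply hψ, map_prod, map_pow]
  exact DFunLike.congr_fun h f

omit hθ hψ

theorem compose_X_right (f : MvPowerSeries I A) : compose f (X : I → MvPowerSeries I k) = f := by
  have hX : ∀ j, constantCoeff (X j : MvPowerSeries I k) = 0 := fun j => constantCoeff_X j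
  have h : composeAddHom hX = AddMonoidHom.id (MvPowerSeries I A) := by
    refine addHom_ext_of_monomial (fun n => ⟨n, fun f hf => hf.compose hX⟩)
      (fun n => ⟨n, fun f hf => hf⟩) fun e u => ?_
    change compose (monomial e u) _ = monomial e u
    rw [compose_monomial hX, monomialAt_X, map_monomial, map_one,
      ← monomial_zero_eq_C_apply, monomial_mul_monomial, add_zero, one_mul]
  exact DFunLike.congr_fun h f

include hθ in
/-- The chain rule. -/
theorem partialDeriv_compose (i : I) (f : MvPowerSeries I A) :
    partialDeriv i (compose f θ) =
      ∑ j, scal (partialDeriv i (θ j)) * compose (partialDeriv j f) θ := by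
  classical
  -- Both sides are continuous derivations along composition with `θ`, which agree on constants and on
  -- the variables.
  let F : MvPowerSeries I A →+ MvPowerSeries I A :=
    (partialDerivHom i).comp (composeAddHom hθ)
  let G : MvPowerSeries I A →+ MvPowerSeries I A :=
    ∑ j, (AddMonoidHom.mulLeft (scal (partialDeriv i (θ j)))).comp
      ((composeAddHom hθ).comp (partialDerivHom j))
  have hG' : ∀ f, G f = ∑ j, scal (partialDeriv i (θ j)) * compose (partialDeriv j f) θ := by
    intro f
    simp only [G, AddMonoidHom.finsetSum_apply]
    rfl
  have hFmul : ∀ f g, F (f * g) = F f * compose g θ + compose f θ * F g := by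
    intro f g
    change partialDeriv i (compose (f * g) θ) = _
    rw [compose_mul hθ, partialDeriv_mul]
    rfl
  have hGmul : ∀ f g, G (f * g) = G f * compose g θ + compose f θ * G g := by
    intro f g
    rw [hG', hG', hG', Finset.sum_mul, Finset.mul_sum, ← Finset.sum_add_distrib]
    refine Finset.sum_congr rfl fun j _ => ?_
    rw [partialDeriv_mul, ← composeHom_apply hθ, map_add, map_mul, map_mul]
    simp only [composeHom_apply]
    rw [mul_add, mul_assoc, ← mul_assoc (compose f θ),
      ← (scal_commute (partialDeriv i (θ j)) (compose f θ)).eq, mul_assoc]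
  have hC : ∀ u, F (C u) = G (C u) := by
    intro u
    rw [hG']
    change partialDeriv i (compose (C u) θ) = _
    rw [compose_C hθ, partialDeriv_C]
    simp only [partialDeriv_C]
    simp only [← composeHom_apply hθ, map_zero, mul_zero, Finset.sum_const_zero]
  have hX : ∀ j, F (X j) = G (X j) := by
    intro j
    rw [hG']
    change partialDeriv i (compose (X j) θ) = _
    rw [compose_X hθ, Finset.sum_eq_single j, partialDeriv_X_self, partialDeriv_map,
      ← composeHom_apply hθ, map_one, mul_one]
    · intro j' _ hne
      rw [partialDeriv_X_of_ne hne, ← composeHom_apply hθ, map_zero, mul_zero]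
    · simp
  have hmon : ∀ e : I →₀ ℕ, F (monomial e 1) = G (monomial e 1) := by
    intro e
    induction e using Finsupp.induction_linear with
    | zero => simpa only [monomial_zero_eq_C_apply] using hC 1
    | add e e' h h' =>
      have : (monomial (e + e') 1 : MvPowerSeries I A) = monomial e 1 * monomial e' 1 := by
        rw [monomial_mul_monomial, one_mul]
      rw [this, hFmul, hGmul, h, h']
    | single j n =>
      induction n with
      | zero => simpa only [single_zero, monomial_zero_eq_C_apply] using hC 1
      | succ n ih =>
        have : (monomial (single j (n + 1)) 1 : MvPowerSeries I A) =
            monomial (single j n) 1 * X j := by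
          rw [X_def, monomial_mul_monomial, one_mul, single_add]
        rw [this, hFmul, hGmul, ih, hX]
  have h : F = G := by
    refine addHom_ext_of_monomial
      (fun n => ⟨n + 1, fun f hf => (hf.compose hθ).partialDeriv i⟩)
      (fun n => ⟨n + 1, fun f hf => ?_⟩) fun e u => ?_
    · rw [hG']
      exact OrdGE.sum fun j _ => ((hf.partialDeriv j).compose hθ).mul_left
    · have : monomial e u = monomial e 1 * C u := by
        rw [← monomial_zero_eq_C_apply, monomial_mul_monomial, one_mul, add_zero]
      rw [this, hFmul, hGmul, hmon, hC]
  rw [← hG', ← h]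
  rfl

/-- A formal map tangent to the identity has a left inverse for composition. -/
theorem exists_compose_eq_X (hθ : ∀ j, OrdGE 2 (θ j - X j)) :
    ∃ ψ : I → MvPowerSeries I k, (∀ j, constantCoeff (ψ j) = 0) ∧ ∀ j, compose (ψ j) θ = X j := by
  have hθ0 : ∀ j, constantCoeff (θ j) = 0 := fun j => by
    have := OrdGE.one_iff.1 ((hθ j).mono one_le_two)
    rwa [map_sub, constantCoeff_X, sub_zero] at this
  -- As `lam ^ e - θ ^ e` has order greater than `|e|`, the map `f ↦ f - f ∘ θ` is contracting.
  have hmon : ∀ e : I →₀ ℕ, OrdGE (e.degree + 1) (monomial e 1 - monomialAt θ e) := by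
    intro e
    have hadd : ∀ e e' : I →₀ ℕ, OrdGE (e.degree + 1) (monomial e 1 - monomialAt θ e) →
        OrdGE (e'.degree + 1) (monomial e' 1 - monomialAt θ e') →
        OrdGE ((e + e').degree + 1) (monomial (e + e') 1 - monomialAt θ (e + e')) := by
      intro e e' h h'
      have hXe : OrdGE e.degree (monomial e (1 : k)) := by
        rw [← monomialAt_X]; exact ordGE_monomialAt (fun j => constantCoeff_X j) e
      have h1 := hXe.mul h'
      have h2 := h.mul (ordGE_monomialAt hθ0 e')
      have h3 : monomial (e + e') 1 - monomialAt θ (e + e') =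
          monomial e 1 * (monomial e' 1 - monomialAt θ e') +
          (monomial e 1 - monomialAt θ e) * monomialAt θ e' := by
        rw [monomialAt_add, mul_sub, sub_mul, monomial_mul_monomial, one_mul]; ring
      rw [h3, map_add]
      exact (h1.mono (by omega)).add (h2.mono (by omega))
    have h0 : OrdGE ((0 : I →₀ ℕ).degree + 1) (monomial 0 1 - monomialAt θ 0) := by
      rw [monomialAt_zero, monomial_zero_one, sub_self]
      exact OrdGE.zero _
    induction e using Finsupp.induction_linear with
    | zero => exact h0
    | add e e' h h' => exact hadd e e' h h'
    | single j n =>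
      induction n with
      | zero => simpa using h0
      | succ n ih =>
        rw [single_add]
        refine hadd _ _ ih ?_
        rw [monomialAt_single, degree_single, ← X_def, ← neg_sub]
        exact (hθ j).neg
  have hcontr : ∀ n (f : MvPowerSeries I k), OrdGE n f → OrdGE (n + 1) (f - compose f θ) := by
    intro n f hf d hd
    rw [map_sub, sub_eq_zero, ← compose_X_right (k := k) f,
      compose_compose (fun j => constantCoeff_X j) hθ0, coeff_compose (fun j => constantCoeff_X j),
      coeff_compose fun j => by rw [constantCoeff_compose hθ0, constantCoeff_X]]
    refine Finset.sum_congr rfl fun e he => ?_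
    rcases lt_or_ge e.degree n with h | h
    · rw [hf e h, smul_zero, smul_zero]
    · congr 1
      have := hmon e d (by omega)
      rw [map_sub, sub_eq_zero] at this
      rw [monomialAt_X, this]
      congr 3
      funext j
      rw [compose_X hθ0, scal_self]
  -- A fixed point `f` of `f ↦ lam_j + (f - f ∘ θ)` satisfies `f ∘ θ = lam_j`.
  have hj : ∀ j, ∃ f : MvPowerSeries I k, X j + (f - compose f θ) = f := by
    intro j
    refine exists_fixedPoint_of_contracting _ fun n f g h => ?_
    have := hcontr n _ h
    rw [← composeHom_apply hθ0, map_sub, composeHom_apply, composeHom_apply] at this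
    convert this using 1
    abel
  choose ψ hψ using hj
  have hψ' : ∀ j, compose (ψ j) θ = X j := fun j => by
    have := hψ j
    rw [← add_sub_assoc, sub_eq_iff_eq_add, add_comm] at this
    exact (add_left_cancel this).symm
  refine ⟨ψ, fun j => ?_, hψ'⟩
  rw [← constantCoeff_compose hθ0, hψ', constantCoeff_X]

end Composition

/-! ### Sums of formal functions of increasing order -/

section Exponential

open MvPowerSeries Finsupp
open Finset.HasAntidiagonal (antidiagonal mem_antidiagonal)

variable {I A : Type*} [Ring A]

/-- The sum `∑ n, f n` of a sequence of formal functions such that `f n` has order at least `n`. -/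
def seriesSum (f : ℕ → MvPowerSeries I A) : MvPowerSeries I A :=
  fun d => ∑ n ∈ Finset.range (d.degree + 1), coeff d (f n)

theorem coeff_seriesSum {f : ℕ → MvPowerSeries I A} (hf : ∀ n, OrdGE n (f n)) {d : I →₀ ℕ}
    {N : ℕ} (h : d.degree < N) : coeff d (seriesSum f) = coeff d (∑ n ∈ Finset.range N, f n) := by
  rw [map_sum]
  refine Finset.sum_subset (Finset.range_subset_range.2 h) fun n _ hn => hf n d ?_
  simp only [Finset.mem_range] at hn
  omega

theorem ordGE_seriesSum_sub {f : ℕ → MvPowerSeries I A} (hf : ∀ n, OrdGE n (f n)) (N : ℕ) :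
    OrdGE N (seriesSum f - ∑ n ∈ Finset.range N, f n) := fun d hd => by
  rw [map_sub, coeff_seriesSum hf hd, sub_self]

/-- The Cauchy product formula. -/
theorem seriesSum_mul {f g : ℕ → MvPowerSeries I A} (hf : ∀ n, OrdGE n (f n))
    (hg : ∀ n, OrdGE n (g n)) :
    seriesSum f * seriesSum g =
      seriesSum fun n => ∑ p ∈ antidiagonal n, f p.1 * g p.2 := by
  classical
  have hfg : ∀ n, OrdGE n (∑ p ∈ antidiagonal n, f p.1 * g p.2) := fun n =>
    OrdGE.sum fun p hp => by
      rw [mem_antidiagonal] at hp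
      rw [← hp]
      exact (hf _).mul (hg _)
  refine sub_eq_zero.1 (OrdGE.eq_zero fun N => ?_)
  set F := ∑ n ∈ Finset.range N, f n with hF
  set G := ∑ n ∈ Finset.range N, g n with hG
  set H := ∑ n ∈ Finset.range N, ∑ p ∈ antidiagonal n, f p.1 * g p.2 with hH
  have h1 : OrdGE N (F * G - H) := by
    set s := (Finset.range N ×ˢ Finset.range N) with hs
    have h2 : F * G = ∑ p ∈ s, f p.1 * g p.2 := by
      rw [hF, hG, Finset.sum_mul_sum, Finset.sum_product]
    have h3 : H = ∑ p ∈ s with p.1 + p.2 < N, f p.1 * g p.2 := by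
      rw [hH, ← Finset.sum_fiberwise_of_maps_to (s := s.filter fun p => p.1 + p.2 < N)
        (t := Finset.range N) (g := fun p => p.1 + p.2)]
      · refine Finset.sum_congr rfl fun n hn => ?_
        refine Finset.sum_congr ?_ fun _ _ => rfl
        ext p
        simp only [hs, mem_antidiagonal, Finset.mem_filter, Finset.mem_product,
          Finset.mem_range] at hn ⊢
        omega
      · intro p hp
        simpa using (Finset.mem_filter.1 hp).2
    rw [h2, h3, ← Finset.sum_filter_add_sum_filter_not s fun p => p.1 + p.2 < N,
      add_sub_cancel_left]
    refine OrdGE.sum fun p hp => ((hf _).mul (hg _)).mono ?_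
    exact not_lt.1 (Finset.mem_filter.1 hp).2
  have h4 : seriesSum f * seriesSum g - seriesSum (fun n => ∑ p ∈ antidiagonal n,
      f p.1 * g p.2) = (seriesSum f - F) * seriesSum g + F * (seriesSum g - G) + (F * G - H)
      - (seriesSum (fun n => ∑ p ∈ antidiagonal n, f p.1 * g p.2) - H) := by
    noncomm_ring
  rw [h4]
  exact (((ordGE_seriesSum_sub hf N).mul_right.add (ordGE_seriesSum_sub hg N).mul_left).add
    h1).sub (ordGE_seriesSum_sub hfg N)

theorem weightDeriv_seriesSum (w : (I →₀ ℕ) →+ ℕ) (f : ℕ → MvPowerSeries I A) :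
    weightDeriv w (seriesSum f) = seriesSum fun n => weightDeriv w (f n) := by
  ext d
  rw [coeff_weightDeriv]
  exact Finset.smul_sum (r := w d) (s := Finset.range (d.degree + 1)) (f := fun n => coeff d (f n))

theorem seriesSum_succ {f : ℕ → MvPowerSeries I A} (hf : ∀ n, OrdGE n (f n)) (h0 : f 0 = 0) :
    seriesSum f = seriesSum fun n => f (n + 1) := by
  ext d
  rw [coeff_seriesSum hf (show d.degree < d.degree + 1 + 1 by omega), Finset.sum_range_succ', h0,
    add_zero, map_sum]
  rfl

/-! ### The logarithmic derivative of the exponential -/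

/-- The iterates `(-ad x) ^ n v` of `v ↦ v x - x v`. -/
def adIter (x v : MvPowerSeries I A) : ℕ → MvPowerSeries I A
  | 0 => v
  | n + 1 => adIter x v n * x - x * adIter x v n

theorem ordGE_adIter {x : MvPowerSeries I A} (hx : OrdGE 1 x) (v : MvPowerSeries I A) (n : ℕ) :
    OrdGE n (adIter x v n) := by
  induction n with
  | zero => exact OrdGE.zero_order _
  | succ n ih =>
    refine (ih.mul hx).sub ?_
    rw [add_comm]
    exact hx.mul ih

theorem sum_choose_adIter_succ (x v : MvPowerSeries I A) (n : ℕ) :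
    ∑ p ∈ antidiagonal (n + 1), (n + 2).choose (p.2 + 1) • (x ^ p.1 * adIter x v p.2) =
      (∑ p ∈ antidiagonal n, (n + 1).choose (p.2 + 1) • (x ^ p.1 * adIter x v p.2)) * x +
        x ^ (n + 1) * v := by
  have h1 : ∀ p : ℕ × ℕ, (n + 2).choose (p.2 + 1) • (x ^ p.1 * adIter x v p.2) =
      (n + 1).choose p.2 • (x ^ p.1 * adIter x v p.2) +
      (n + 1).choose (p.2 + 1) • (x ^ p.1 * adIter x v p.2) := fun p => by
    rw [← add_smul, ← Nat.choose_succ_succ]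
  simp only [h1]
  rw [Finset.sum_add_distrib, Finset.Nat.sum_antidiagonal_succ', Finset.Nat.sum_antidiagonal_succ]
  simp only [Nat.choose_zero_right, one_smul, Nat.choose_succ_self, zero_smul, zero_add]
  rw [add_right_comm, add_comm _ (x ^ (n + 1) * _), add_assoc, add_comm, ← Finset.sum_add_distrib,
    Finset.sum_mul]
  refine (add_comm _ _).trans ?_
  congr 1
  refine Finset.sum_congr rfl fun p _ => ?_
  rw [← smul_add, smul_mul_assoc, adIter, pow_succ]
  congr 1
  noncomm_ring

/-- `D (x ^ (n + 1)) = ∑ i + j = n, (n + 1).choose (j + 1) x ^ i (-ad x) ^ j (D x)`: the expansion of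
`∑ i + j = n, x ^ i (D x) x ^ j` in which all powers of `x` are moved to the left. -/
theorem weightDeriv_pow_succ (w : (I →₀ ℕ) →+ ℕ) (x : MvPowerSeries I A) (n : ℕ) :
    weightDeriv w (x ^ (n + 1)) = ∑ p ∈ antidiagonal n,
      (n + 1).choose (p.2 + 1) • (x ^ p.1 * adIter x (weightDeriv w x) p.2) := by
  induction n with
  | zero => simp [adIter]
  | succ n ih => rw [pow_succ, weightDeriv_mul, ih, sum_choose_adIter_succ]

variable {k : Type*} [Field k] [Algebra k A]

theorem formalExp_eq_seriesSum {x : MvPowerSeries I A} (hx : OrdGE 1 x) :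
    formalExp k x = seriesSum fun n => ((n.factorial : k)⁻¹) • x ^ n := by
  ext d
  refine finsum_eq_sum_of_support_subset (fun n : ℕ => ((n.factorial : k)⁻¹) • coeff d (x ^ n))
    (s := Finset.range (d.degree + 1)) fun n hn => ?_
  simp only [Finset.coe_range, Set.mem_Iio]
  by_contra! h
  refine hn ?_
  change _ • coeff d (x ^ n) = 0
  rw [hx.pow n d h, smul_zero]

theorem ordGE_expTerm {x : MvPowerSeries I A} (hx : OrdGE 1 x) (n : ℕ) :
    OrdGE n (((n.factorial : k)⁻¹) • x ^ n) := (hx.pow n).smul _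

theorem constantCoeff_formalExp {x : MvPowerSeries I A} (hx : OrdGE 1 x) :
    constantCoeff (formalExp k x) = 1 := by
  rw [formalExp_eq_seriesSum hx, ← coeff_zero_eq_constantCoeff_apply,
    coeff_seriesSum (ordGE_expTerm hx) (N := 1) (by simp)]
  simp

/-- `(1 - exp (-ad x)) / ad x` applied to `v`, that is `∑ n, (-ad x) ^ n v / (n + 1)!`. -/
def expLogDeriv (k : Type*) [Field k] [Algebra k A] (x v : MvPowerSeries I A) :
    MvPowerSeries I A :=
  seriesSum fun n => (((n + 1).factorial : k)⁻¹) • adIter x v n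

/-- The derivative of the exponential map: `D (exp x) = exp x * ((1 - exp (-ad x)) / ad x) (D x)`. -/
theorem weightDeriv_formalExp [CharZero k] (w : (I →₀ ℕ) →+ ℕ) {x : MvPowerSeries I A}
    (hx : OrdGE 1 x) :
    weightDeriv w (formalExp k x) = formalExp k x * expLogDeriv k x (weightDeriv w x) := by
  have hsm : ∀ (c : k) (f : MvPowerSeries I A), weightDeriv w (c • f) = c • weightDeriv w f := by
    intro c f
    ext d
    exact smul_comm (w d) c (coeff d f)
  rw [formalExp_eq_seriesSum hx, weightDeriv_seriesSum,
    seriesSum_succ (fun n => (ordGE_expTerm hx n).weightDeriv w), expLogDeriv,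
    seriesSum_mul (ordGE_expTerm hx) fun n => (ordGE_adIter hx _ n).smul _]
  · congr 1
    funext n
    rw [hsm, weightDeriv_pow_succ, Finset.smul_sum]
    refine Finset.sum_congr rfl fun p hp => ?_
    rw [mem_antidiagonal] at hp
    rw [smul_mul_smul_comm, ← Nat.cast_smul_eq_nsmul k, smul_smul]
    congr 1
    rw [Nat.choose_eq_factorial_div_factorial (by omega),
      Nat.cast_div (Nat.factorial_mul_factorial_dvd_factorial (by omega))
        (by exact_mod_cast mul_ne_zero (Nat.factorial_ne_zero _) (Nat.factorial_ne_zero _)),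
      show n + 1 - (p.2 + 1) = p.1 by omega, Nat.cast_mul]
    have h1 : ((n + 1).factorial : k) ≠ 0 := by exact_mod_cast Nat.factorial_ne_zero _
    have h2 : ((p.2 + 1).factorial : k) ≠ 0 := by exact_mod_cast Nat.factorial_ne_zero _
    have h3 : (p.1.factorial : k) ≠ 0 := by exact_mod_cast Nat.factorial_ne_zero _
    field_simp
  · rw [hsm, pow_zero]
    have : weightDeriv w (1 : MvPowerSeries I A) = 0 := by
      have h := weightDeriv_mul w (1 : MvPowerSeries I A) 1
      rw [mul_one, one_mul] at h
      simpa using h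
    rw [this, smul_zero]

/-! ### The exponential map is onto -/

theorem OrdGE.pow_sub_pow {x y : MvPowerSeries I A} (hx : OrdGE 1 x) (hy : OrdGE 1 y) {n : ℕ}
    (h : OrdGE n (x - y)) (m : ℕ) : OrdGE (n + m) (x ^ (m + 1) - y ^ (m + 1)) := by
  induction m with
  | zero => simpa using h
  | succ m ih =>
    have h1 : x ^ (m + 2) - y ^ (m + 2) =
        x ^ (m + 1) * (x - y) + (x ^ (m + 1) - y ^ (m + 1)) * y := by
      rw [pow_succ x, pow_succ y]; noncomm_ring
    rw [h1]
    exact (((hx.pow (m + 1)).mul h).mono (by omega)).add ((ih.mul hy).mono (by omega))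

/-- `exp x - x` is contracting on series without constant term. -/
theorem OrdGE.formalExp_sub {x y : MvPowerSeries I A} (hx : OrdGE 1 x) (hy : OrdGE 1 y) {n : ℕ}
    (h : OrdGE n (x - y)) :
    OrdGE (n + 1) (formalExp k x - x - (formalExp k y - y)) := fun d hd => by
  rw [map_sub, map_sub, map_sub, formalExp_eq_seriesSum hx, formalExp_eq_seriesSum hy,
    coeff_seriesSum (ordGE_expTerm hx) (show d.degree < d.degree + 1 + 1 by omega),
    coeff_seriesSum (ordGE_expTerm hy) (show d.degree < d.degree + 1 + 1 by omega),
    Finset.sum_range_succ', Finset.sum_range_succ', Finset.sum_range_succ', Finset.sum_range_succ']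
  simp only [map_add, zero_add, Nat.factorial_one, Nat.factorial_zero, Nat.cast_one, inv_one,
    one_smul, pow_one, pow_zero, add_assoc]
  have h1 : coeff d (∑ m ∈ Finset.range d.degree, (((m + (1 + 1)).factorial : k)⁻¹) •
        x ^ (m + (1 + 1))) = coeff d (∑ m ∈ Finset.range d.degree,
        (((m + (1 + 1)).factorial : k)⁻¹) • y ^ (m + (1 + 1))) := by
    rw [← sub_eq_zero, ← map_sub, ← Finset.sum_sub_distrib]
    refine OrdGE.sum (fun m _ => ?_) d hd
    rw [← smul_sub]
    exact ((hx.pow_sub_pow hy h (m + 1)).mono (by omega)).smul _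
  rw [h1]
  abel

theorem exists_formalExp_eq {g : MvPowerSeries I A} (hg : constantCoeff g = 1) :
    ∃ x, OrdGE 1 x ∧ formalExp k x = g := by
  have h0 : ∀ f : MvPowerSeries I A, OrdGE 1 (f - C (constantCoeff f)) := fun f =>
    OrdGE.one_iff.2 (by simp)
  have hC : ∀ n (f : MvPowerSeries I A), OrdGE n f →
      OrdGE n (C (constantCoeff f) : MvPowerSeries I A) := by
    classical
    intro n f hf d hd
    rw [coeff_C]
    split_ifs with h
    · subst h
      simpa using hf 0 hd
    · rfl
  -- Solve `x = g - (exp x - x)`. Constant terms are removed first, because the exponential is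
  -- contracting only on series without constant term.
  obtain ⟨x, hx⟩ := exists_fixedPoint_of_contracting (fun f : MvPowerSeries I A =>
      g - (formalExp k (f - C (constantCoeff f)) - (f - C (constantCoeff f)))) (by
    intro n f f' h
    have h1 : OrdGE n (f - C (constantCoeff f) - (f' - C (constantCoeff f'))) := by
      have := h.sub (hC _ _ h)
      convert this using 1
      rw [map_sub, map_sub]
      abel
    have h2 := ((h0 f).formalExp_sub (k := k) (h0 f') h1).neg
    convert h2 using 1
    abel)
  have hx0 : constantCoeff x = 0 := by
    rw [← hx, map_sub, map_sub, constantCoeff_formalExp (h0 x), OrdGE.one_iff.1 (h0 x), hg]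
    simp
  refine ⟨x, OrdGE.one_iff.2 hx0, ?_⟩
  simp only [hx0, map_zero, sub_zero] at hx
  rw [sub_eq_iff_eq_add, add_sub_cancel] at hx
  exact hx.symm

/-! ### Exponentials of formal functions with values in a Lie subalgebra -/

variable (L : Submodule k A)

/-- The coefficients of degree less than `D` lie in `L`. -/
def CoeffsIn (D : ℕ) (f : MvPowerSeries I A) : Prop :=
  ∀ d : I →₀ ℕ, d.degree < D → coeff d f ∈ L

variable {L} (hL : ∀ u ∈ L, ∀ v ∈ L, u * v - v * u ∈ L)
include hL

/-- The bracket with a series without constant term only involves coefficients of lower degree, hence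
the gain of one degree. -/
theorem coeffsIn_bracket {D : ℕ} {x v : MvPowerSeries I A} (hx : OrdGE 1 x) (hv : OrdGE 1 v)
    (hxL : CoeffsIn L D x) (hvL : CoeffsIn L D v) : CoeffsIn L (D + 1) (v * x - x * v) := by
  classical
  intro d hd
  rw [map_sub, coeff_mul, coeff_mul,
    Finsupp.sum_antidiagonal_swap d fun a b => coeff a x * coeff b v, ← Finset.sum_sub_distrib]
  refine L.sum_mem fun p hp => ?_
  rw [mem_antidiagonal] at hp
  have hdeg : p.1.degree + p.2.degree = d.degree := by rw [← hp, map_add]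
  rcases Nat.eq_zero_or_pos p.1.degree with h1 | h1
  · rw [hv p.1 (by omega)]; simp
  rcases Nat.eq_zero_or_pos p.2.degree with h2 | h2
  · rw [hx p.2 (by omega)]; simp
  exact hL _ (hvL _ (by omega)) _ (hxL _ (by omega))

theorem coeffsIn_adIter {D : ℕ} {x v : MvPowerSeries I A} (hx : OrdGE 1 x) (hv : OrdGE 1 v)
    (hxL : CoeffsIn L D x) (hvL : CoeffsIn L D v) (n : ℕ) :
    OrdGE 1 (adIter x v n) ∧ CoeffsIn L D (adIter x v n) := by
  induction n with
  | zero => exact ⟨hv, hvL⟩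
  | succ n ih =>
    exact ⟨ih.1.mul_right.sub ih.1.mul_left, fun d hd =>
      coeffsIn_bracket hL hx ih.1 hxL ih.2 d (hd.trans D.lt_succ_self)⟩

/-- `expLogDeriv k x v - v` is made of brackets, so modulo `L` its coefficients of degree at most `D`
are determined by those of `x` and `v` of degree less than `D`. -/
theorem coeff_expLogDeriv_sub_mem {D : ℕ} {x v : MvPowerSeries I A} (hx : OrdGE 1 x)
    (hv : OrdGE 1 v) (hxL : CoeffsIn L D x) (hvL : CoeffsIn L D v) {d : I →₀ ℕ}
    (hd : d.degree < D + 1) : coeff d (expLogDeriv k x v) - coeff d v ∈ L := by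
  rw [expLogDeriv, coeff_seriesSum (fun n => (ordGE_adIter hx v n).smul _)
    (show d.degree < d.degree + 1 by omega), Finset.sum_range_succ', map_add]
  simp only [zero_add, Nat.factorial_one, Nat.cast_one, inv_one, one_smul, adIter,
    add_sub_cancel_right, map_sum]
  refine L.sum_mem fun n _ => L.smul_mem _ ?_
  obtain ⟨h1, h2⟩ := coeffsIn_adIter hL hx hv hxL hvL n
  exact coeffsIn_bracket hL hx h1 hxL h2 d hd

omit hL in
theorem isUnit_of_constantCoeff_eq_one {g : MvPowerSeries I A} (hg : constantCoeff g = 1) :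
    IsUnit g := by
  rw [isUnit_iff_constantCoeff, hg]; exact isUnit_one

/-- The logarithmic derivatives of the exponential of an `L`-valued series are `L`-valued. -/
theorem partialDeriv_formalExp [CharZero k] {x : MvPowerSeries I A} (hx : OrdGE 1 x)
    (hxL : ∀ d, coeff d x ∈ L) (i : I) :
    ∃ c : MvPowerSeries I A, (∀ d, coeff d c ∈ L) ∧
      partialDeriv i (formalExp k x) = formalExp k x * c := by
  have hu := isUnit_of_constantCoeff_eq_one (constantCoeff_formalExp (k := k) hx)
  refine ⟨Ring.inverse (formalExp k x) * partialDeriv i (formalExp k x), fun d => ?_,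
    (Ring.mul_inverse_cancel_left _ _ hu).symm⟩
  set g := formalExp k x with hg
  have h1 : X i * (Ring.inverse g * partialDeriv i g) =
      expLogDeriv k x (weightDeriv (applyAddHom i) x) := by
    rw [← mul_assoc, ← (commute_X (Ring.inverse g) i).eq, mul_assoc, X_mul_partialDeriv,
      hg, weightDeriv_formalExp _ hx, ← hg, Ring.inverse_mul_cancel_left _ _ hu]
  have h2 := congrArg (coeff (single i 1 + d)) h1
  rw [X_def, coeff_add_monomial_mul, one_mul] at h2
  rw [h2]
  have hvL : ∀ d, coeff d (weightDeriv (applyAddHom i) x) ∈ L := fun d => by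
    rw [coeff_weightDeriv]; exact nsmul_mem (hxL d) _
  have := coeff_expLogDeriv_sub_mem hL hx (hx.weightDeriv _) (D := (single i 1 + d).degree)
    (fun d _ => hxL d) (fun d _ => hvL d) (Nat.lt_succ_self _)
  have h3 := L.add_mem this (hvL (single i 1 + d))
  rwa [sub_add_cancel] at h3

/-- A series with constant term `1` and `L`-valued logarithmic derivatives is the exponential of an
`L`-valued series. -/
theorem exists_formalExp_of_partialDeriv [Fintype I] [CharZero k] {g : MvPowerSeries I A}
    (hg : constantCoeff g = 1)
    (h : ∀ i, ∃ c : MvPowerSeries I A, (∀ d, coeff d c ∈ L) ∧ partialDeriv i g = g * c) :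
    ∃ x : MvPowerSeries I A, (∀ d, coeff d x ∈ L) ∧ constantCoeff x = 0 ∧ g = formalExp k x := by
  classical
  obtain ⟨x, hx, rfl⟩ := exists_formalExp_eq (k := k) hg
  refine ⟨x, ?_, OrdGE.one_iff.1 hx, rfl⟩
  choose c hc hgc using h
  have hu := isUnit_of_constantCoeff_eq_one hg
  set E : MvPowerSeries I A →+ MvPowerSeries I A := weightDeriv Finsupp.degree with hE
  have h1 : E (formalExp k x) = formalExp k x * ∑ i, X i * c i := by
    have : E (formalExp k x) = ∑ i, X i * partialDeriv i (formalExp k x) := by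
      ext d
      simp only [X_mul_partialDeriv, map_sum, coeff_weightDeriv, hE, applyAddHom_apply,
        ← Finset.sum_smul]
      rw [Finsupp.degree_eq_sum]
    rw [this, Finset.mul_sum]
    refine Finset.sum_congr rfl fun i _ => ?_
    rw [hgc, ← mul_assoc, ← mul_assoc, (commute_X (formalExp k x) i).eq]
  have h2 : expLogDeriv k x (E x) = ∑ i, X i * c i := by
    rw [weightDeriv_formalExp _ hx] at h1
    exact hu.mul_left_cancel h1
  have h3 : ∀ d, coeff d (expLogDeriv k x (E x)) ∈ L := by
    intro d
    rw [h2, map_sum]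
    refine L.sum_mem fun i _ => ?_
    rw [X_def, coeff_monomial_mul]
    split_ifs
    · rw [one_mul]; exact hc _ _
    · exact L.zero_mem
  -- In degree `D`, the logarithmic derivative is `D x_D` plus brackets of coefficients of `x` of lower
  -- degree.
  have h4 : ∀ D, CoeffsIn L D x := by
    intro D
    induction D with
    | zero => exact fun d hd => absurd hd (Nat.not_lt_zero _)
    | succ D ih =>
      intro d hd
      have hEL : CoeffsIn L D (E x) := fun d hd => by
        rw [hE, coeff_weightDeriv]; exact nsmul_mem (ih d hd) _
      have h5 := L.sub_mem (h3 d) (coeff_expLogDeriv_sub_mem hL hx (hx.weightDeriv _) ih hEL hd)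
      rw [sub_sub_cancel, coeff_weightDeriv, ← Nat.cast_smul_eq_nsmul k] at h5
      rcases Nat.eq_zero_or_pos d.degree with h6 | h6
      · rw [hx d (by omega)]; exact L.zero_mem
      · exact (L.smul_mem_iff (by exact_mod_cast h6.ne')).1 h5
  exact fun d => h4 (d.degree + 1) d (Nat.lt_succ_self _)

end Exponential

/-! ### Formal functions with values in the Lie algebra -/

section Adjoint

open MvPowerSeries Matrix
open scoped Ring

variable {k 𝔤 I : Type*} [Field k] [LieRing 𝔤] [LieAlgebra k 𝔤]

/-- `U(𝔤)⟦lam_i⟧` is an algebra over its central subring `k⟦lam_i⟧`. -/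
instance instAlgebraFormal : Algebra (MvPowerSeries I k)
    (MvPowerSeries I (UniversalEnvelopingAlgebra k 𝔤)) :=
  RingHom.toAlgebra' scal fun r f => scal_commute r f

theorem smul_eq_scal_mul (r : MvPowerSeries I k)
    (f : MvPowerSeries I (UniversalEnvelopingAlgebra k 𝔤)) : r • f = scal r * f := rfl

theorem partialDeriv_smul (i : I) (r : MvPowerSeries I k)
    (f : MvPowerSeries I (UniversalEnvelopingAlgebra k 𝔤)) :
    partialDeriv i (r • f) = partialDeriv i r • f + r • partialDeriv i f := by
  rw [smul_eq_scal_mul, partialDeriv_mul, partialDeriv_map]; rfl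

theorem C_smul (c : k) (f : MvPowerSeries I (UniversalEnvelopingAlgebra k 𝔤)) :
    (C c : MvPowerSeries I k) • f = c • f := by
  ext d
  rw [smul_eq_scal_mul, map_C, coeff_C_mul, ← Algebra.smul_def]
  rfl

theorem coeff_smul_constVec (r : MvPowerSeries I k) (v : 𝔤) (d : I →₀ ℕ) :
    coeff d (r • (constVec v : MvPowerSeries I (UniversalEnvelopingAlgebra k 𝔤))) =
      coeff d r • UniversalEnvelopingAlgebra.ι k v := by
  rw [smul_eq_scal_mul, constVec, coeff_mul_C, coeff_map, ← Algebra.smul_def]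

variable [Fintype I] (b : Module.Basis I k 𝔤)

theorem compose_smul {θ : I → MvPowerSeries I k} (hθ : ∀ j, constantCoeff (θ j) = 0)
    (r : MvPowerSeries I k) (f : MvPowerSeries I (UniversalEnvelopingAlgebra k 𝔤)) :
    compose (r • f) θ = compose r θ • compose f θ := by
  rw [smul_eq_scal_mul, compose_mul hθ, compose_scal hθ]; rfl

/-- The formal function `∑ m, c_m e_m` with values in `𝔤`, inside `U(𝔤)⟦lam_i⟧`. -/
def vec : (I → MvPowerSeries I k) →ₗ[MvPowerSeries I k]
    MvPowerSeries I (UniversalEnvelopingAlgebra k 𝔤) :=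
  Fintype.linearCombination (MvPowerSeries I k) fun m => constVec (b m)

theorem vec_apply (c : I → MvPowerSeries I k) : vec b c = ∑ m, c m • constVec (b m) := rfl

theorem coeff_vec (c : I → MvPowerSeries I k) (d : I →₀ ℕ) :
    coeff d (vec b c) = UniversalEnvelopingAlgebra.ι k (∑ m, coeff d (c m) • b m) := by
  rw [vec_apply, map_sum, map_sum]
  refine Finset.sum_congr rfl fun m _ => ?_
  rw [coeff_smul_constVec, map_smul]

theorem exists_vec_eq {f : MvPowerSeries I (UniversalEnvelopingAlgebra k 𝔤)}
    (hf : ∀ d, coeff d f ∈ Set.range (UniversalEnvelopingAlgebra.ι k (L := 𝔤))) :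
    ∃ c, vec b c = f := by
  choose v hv using hf
  let c : I → MvPowerSeries I k := fun m d => b.repr (v d) m
  refine ⟨c, ?_⟩
  ext d
  rw [coeff_vec, ← hv d]
  congr 1
  exact b.sum_repr (v d)

theorem partialDeriv_vec (i : I) (c : I → MvPowerSeries I k) :
    partialDeriv i (vec b c) = vec b fun m => partialDeriv i (c m) := by
  simp only [vec_apply, partialDeriv_sum, partialDeriv_smul, constVec, partialDeriv_C, smul_zero,
    add_zero]

theorem compose_vec {θ : I → MvPowerSeries I k} (hθ : ∀ j, constantCoeff (θ j) = 0)
    (c : I → MvPowerSeries I k) : compose (vec b c) θ = vec b fun m => compose (c m) θ := by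
  rw [vec_apply, ← composeHom_apply hθ, map_sum]
  simp only [composeHom_apply, compose_smul hθ, constVec, compose_C hθ]
  rfl

variable [DecidableEq I]

theorem vec_single (j : I) : vec b (Pi.single j 1) = constVec (b j) := by
  rw [vec, Fintype.linearCombination_apply_single, one_smul]

/-! ### The adjoint matrix -/

/-- The adjoint representation of `U(𝔤)` in matrices. -/
def adRep : UniversalEnvelopingAlgebra k 𝔤 →ₐ[k] Matrix I I k :=
  (LinearMap.toMatrixAlgEquiv b).toAlgHom.comp (adjointRep k 𝔤)

theorem adRep_apply (u : UniversalEnvelopingAlgebra k 𝔤) (m j : I) :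
    adRep b u m j = b.repr (adjointRep k 𝔤 u (b j)) m :=
  LinearMap.toMatrixAlgEquiv_apply _ _ _ _

theorem adRep_ι (v : 𝔤) (m j : I) :
    adRep b (UniversalEnvelopingAlgebra.ι k v) m j = b.repr ⁅v, b j⁆ m := by
  rw [adRep_apply, adjointRep, UniversalEnvelopingAlgebra.lift_ι_apply, LieAlgebra.ad_apply]

/-- The matrix of `Ad (g (lam))`. -/
def adMat : MvPowerSeries I (UniversalEnvelopingAlgebra k 𝔤) →+*
    Matrix I I (MvPowerSeries I k) where
  toFun g := Matrix.of fun m j d => adRep b (coeff d g) m j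
  map_one' := by
    ext m j d
    change adRep b (coeff d 1) m j = _
    rw [coeff_one, Matrix.one_apply]
    split_ifs with h h' h' <;> simp [coeff_one, h, h']
  map_mul' f g := by
    ext m j d
    change adRep b (coeff d (f * g)) m j = coeff d _
    rw [coeff_mul, map_sum, Matrix.sum_apply, Matrix.mul_apply, map_sum]
    simp only [coeff_mul, map_mul, Matrix.mul_apply]
    rw [Finset.sum_comm]
    rfl
  map_zero' := by
    ext m j d
    change adRep b (coeff d 0) m j = _
    simp
  map_add' f g := by
    ext m j d
    change adRep b (coeff d (f + g)) m j = adRep b (coeff d f) m j + adRep b (coeff d g) m j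
    simp

theorem coeff_adMat (g : MvPowerSeries I (UniversalEnvelopingAlgebra k 𝔤)) (m j : I)
    (d : I →₀ ℕ) : coeff d (adMat b g m j) = adRep b (coeff d g) m j := rfl

theorem adMat_constVec (v : 𝔤) (m j : I) :
    adMat b (constVec v) m j = C (b.repr ⁅v, b j⁆ m) := by
  ext d
  rw [coeff_adMat, constVec, coeff_C, coeff_C]
  split_ifs
  · rw [adRep_ι]
  · simp

theorem adMat_smul (r : MvPowerSeries I k)
    (f : MvPowerSeries I (UniversalEnvelopingAlgebra k 𝔤)) :
    adMat b (r • f) = r • adMat b f := by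
  ext m j d
  rw [coeff_adMat, smul_eq_scal_mul, coeff_mul, map_sum, Matrix.sum_apply, Matrix.smul_apply,
    smul_eq_mul, coeff_mul]
  refine Finset.sum_congr rfl fun p _ => ?_
  rw [coeff_map, ← Algebra.smul_def, map_smul, Matrix.smul_apply, smul_eq_mul, coeff_adMat]

theorem adMat_vec (c : I → MvPowerSeries I k) (m j : I) :
    adMat b (vec b c) m j = ∑ p, c p * C (b.repr ⁅b p, b j⁆ m) := by
  rw [vec_apply, map_sum, Matrix.sum_apply]
  refine Finset.sum_congr rfl fun p _ => ?_
  rw [adMat_smul, Matrix.smul_apply, adMat_constVec, smul_eq_mul]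

theorem partialDeriv_adMat (i : I) (g : MvPowerSeries I (UniversalEnvelopingAlgebra k 𝔤))
    (m j : I) : partialDeriv i (adMat b g m j) = adMat b (partialDeriv i g) m j := by
  ext d
  rw [coeff_partialDeriv, coeff_adMat, coeff_adMat, coeff_partialDeriv, map_nsmul,
    Matrix.smul_apply]

theorem compose_adMat {θ : I → MvPowerSeries I k} (hθ : ∀ j, constantCoeff (θ j) = 0)
    (g : MvPowerSeries I (UniversalEnvelopingAlgebra k 𝔤)) (m j : I) :
    compose (adMat b g m j) θ = adMat b (compose g θ) m j := by
  ext d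
  simp only [coeff_adMat, coeff_compose hθ, map_sum, map_smul, Matrix.sum_apply,
    Matrix.smul_apply]

/-- `[y, y'] = ad (y) y'` in coordinates. -/
theorem vec_bracket (c c' : I → MvPowerSeries I k) :
    vec b c * vec b c' - vec b c' * vec b c = vec b (adMat b (vec b c) *ᵥ c') := by
  have h1 : ∀ u v : 𝔤, (constVec u * constVec v - constVec v * constVec u :
      MvPowerSeries I (UniversalEnvelopingAlgebra k 𝔤)) = constVec ⁅u, v⁆ := by
    intro u v
    simp only [constVec, ← map_mul, ← map_sub, LieHom.map_lie, LieRing.of_associative_ring_bracket]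
  have h2 : ∀ v : 𝔤, (constVec v : MvPowerSeries I (UniversalEnvelopingAlgebra k 𝔤)) =
      ∑ m, (C (b.repr v m) : MvPowerSeries I k) • constVec (b m) := by
    intro v
    simp only [C_smul]
    conv_lhs => rw [← b.sum_repr v]
    simp only [constVec, map_sum, map_smul]
    refine Finset.sum_congr rfl fun m _ => ?_
    ext d
    change coeff d (C _ : MvPowerSeries I (UniversalEnvelopingAlgebra k 𝔤)) =
      b.repr v m • coeff d (C _ : MvPowerSeries I (UniversalEnvelopingAlgebra k 𝔤))
    rw [coeff_C, coeff_C]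
    split_ifs <;> simp
  have h3 : vec b c * vec b c' - vec b c' * vec b c =
      ∑ p, ∑ q, (c p * c' q) • constVec ⁅b p, b q⁆ := by
    simp only [vec_apply, Finset.sum_mul_sum]
    rw [Finset.sum_comm (s := Finset.univ) (t := Finset.univ) (f := fun p q =>
      (c' p • constVec (b p)) * (c q • constVec (b q) :
        MvPowerSeries I (UniversalEnvelopingAlgebra k 𝔤))), ← Finset.sum_sub_distrib]
    refine Finset.sum_congr rfl fun p _ => ?_
    rw [← Finset.sum_sub_distrib]
    refine Finset.sum_congr rfl fun q _ => ?_
    rw [smul_mul_smul_comm, smul_mul_smul_comm, mul_comm (c' q), ← smul_sub, h1]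
  rw [h3, vec_apply]
  simp only [fun p q => h2 ⁅b p, b q⁆, Matrix.mulVec, dotProduct, adMat_vec, Finset.sum_mul,
    Finset.sum_smul, Finset.smul_sum, smul_smul]
  rw [Finset.sum_comm_cycle]
  refine Finset.sum_congr rfl fun m _ => ?_
  rw [Finset.sum_comm]
  refine Finset.sum_congr rfl fun q _ => Finset.sum_congr rfl fun p _ => ?_
  rw [mul_right_comm]

/-! ### Formal maps into the group and their logarithmic derivatives -/

/-- `g⁻¹ ∂_{ε^i} g = ∑ m, a_{im} e_m` for all `i`. -/
def HasLogDeriv (g : MvPowerSeries I (UniversalEnvelopingAlgebra k 𝔤))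
    (a : Matrix I I (MvPowerSeries I k)) : Prop :=
  ∀ i, partialDeriv i g = g * vec b (a i)

omit [DecidableEq I] in
/-- Formal maps into the group are the series with constant term `1` and `𝔤`-valued logarithmic
derivatives. -/
theorem mem_map0_iff [CharZero k] {g : MvPowerSeries I (UniversalEnvelopingAlgebra k 𝔤)} :
    g ∈ map0 k 𝔤 I ↔ constantCoeff g = 1 ∧ ∃ a, HasLogDeriv b g a := by
  let L : Submodule k (UniversalEnvelopingAlgebra k 𝔤) :=
    LinearMap.range (UniversalEnvelopingAlgebra.ι k (L := 𝔤) : 𝔤 →ₗ[k] _)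
  have hL : ∀ u ∈ L, ∀ v ∈ L, u * v - v * u ∈ L := by
    rintro _ ⟨u, rfl⟩ _ ⟨v, rfl⟩
    refine ⟨⁅u, v⁆, ?_⟩
    simp [LieRing.of_associative_ring_bracket]
  constructor
  · rintro ⟨x, hx, hx0, rfl⟩
    rw [← OrdGE.one_iff] at hx0
    refine ⟨constantCoeff_formalExp hx0, ?_⟩
    choose c hc hgc using fun i => partialDeriv_formalExp (k := k) (L := L) hL hx0 hx i
    choose a ha using fun i => exists_vec_eq b (hc i)
    exact ⟨a, fun i => by rw [hgc, ha]⟩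
  · rintro ⟨hg, a, ha⟩
    exact exists_formalExp_of_partialDeriv (L := L) hL hg fun i =>
      ⟨vec b (a i), fun d => ⟨_, (coeff_vec b (a i) d).symm⟩, ha i⟩

variable {b} {g h : MvPowerSeries I (UniversalEnvelopingAlgebra k 𝔤)}
  {a a' : Matrix I I (MvPowerSeries I k)}

theorem inverse_eq_of_mul_eq_one {M : Type*} [MonoidWithZero M] {x y : M} (h : x * y = 1)
    (h' : y * x = 1) : Ring.inverse x = y :=
  Ring.inverse_unit ⟨x, y, h, h'⟩

omit [Fintype I] [DecidableEq I] in
theorem constantCoeff_inverse (hg : constantCoeff g = 1) : constantCoeff (Ring.inverse g) = 1 := by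
  have := congrArg constantCoeff (Ring.inverse_mul_cancel g (isUnit_of_constantCoeff_eq_one hg))
  rwa [map_mul, hg, mul_one, map_one] at this

omit [DecidableEq I] in
theorem partialDeriv_inverse (hg : constantCoeff g = 1) (ha : HasLogDeriv b g a) (i : I) :
    partialDeriv i (Ring.inverse g) = -(vec b (a i) * Ring.inverse g) := by
  have hu := isUnit_of_constantCoeff_eq_one hg
  have h1 := congrArg (partialDeriv i) (Ring.mul_inverse_cancel g hu)
  rw [partialDeriv_mul, partialDeriv_one, ha, mul_assoc, ← mul_add] at h1
  exact eq_neg_of_add_eq_zero_right (hu.mul_right_eq_zero.1 h1)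

theorem constantCoeff_adMat_inverse (hg : constantCoeff g = 1) (m j : I) :
    constantCoeff (adMat b (Ring.inverse g) m j) = (1 : Matrix I I k) m j := by
  rw [← coeff_zero_eq_constantCoeff_apply, coeff_adMat, coeff_zero_eq_constantCoeff_apply,
    constantCoeff_inverse hg, map_one]

theorem partialDeriv_adMat_inverse (hg : constantCoeff g = 1) (ha : HasLogDeriv b g a) (i m j : I) :
    partialDeriv i (adMat b (Ring.inverse g) m j) =
      -(adMat b (vec b (a i)) * adMat b (Ring.inverse g)) m j := by
  rw [partialDeriv_adMat, partialDeriv_inverse hg ha, map_neg, map_mul, Matrix.neg_apply]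

/-- Conjugation by a formal map into the group is its adjoint action: the difference has zero
derivative, and it vanishes at `0`. -/
theorem constVec_mul [CharZero k] (hg : constantCoeff g = 1) (ha : HasLogDeriv b g a) (j : I) :
    constVec (b j) * g = g * vec b ((adMat b (Ring.inverse g))ᵀ j) := by
  have : IsAddTorsionFree (UniversalEnvelopingAlgebra k 𝔤) := by
    let _ : Module ℚ (UniversalEnvelopingAlgebra k 𝔤) := Module.compHom _ (algebraMap ℚ k)
    exact IsAddTorsionFree.of_module_rat _
  have hu := isUnit_of_constantCoeff_eq_one hg
  set M := adMat b (Ring.inverse g) with hM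
  set v := vec b (Mᵀ j) with hv
  have hdv : ∀ i, partialDeriv i v = -(vec b (a i) * v - v * vec b (a i)) := by
    intro i
    rw [hv, vec_bracket, partialDeriv_vec, ← map_neg]
    congr 1
    funext m
    simp only [transpose_apply, Pi.neg_apply, hM]
    rw [partialDeriv_adMat_inverse hg ha]
    rfl
  have h1 : constVec (b j) = g * v * Ring.inverse g := by
    refine eq_of_partialDeriv_eq ?_ fun i => ?_
    · rw [map_mul, map_mul, hg, constantCoeff_inverse hg, one_mul, mul_one, hv, constVec,
        constantCoeff_C, ← coeff_zero_eq_constantCoeff_apply, coeff_vec]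
      congr 1
      simp only [coeff_zero_eq_constantCoeff_apply, transpose_apply, hM]
      simp only [constantCoeff_adMat_inverse hg, Matrix.one_apply, ite_smul, one_smul, zero_smul,
        Finset.sum_ite_eq', Finset.mem_univ, if_true]
    · rw [constVec, partialDeriv_C, partialDeriv_mul, partialDeriv_mul, ha, hdv,
        partialDeriv_inverse hg ha]
      noncomm_ring
  rw [h1, Ring.inverse_mul_cancel_right _ _ hu]

theorem vec_mul [CharZero k] (hg : constantCoeff g = 1) (ha : HasLogDeriv b g a)
    (c : I → MvPowerSeries I k) :
    vec b c * g = g * vec b (adMat b (Ring.inverse g) *ᵥ c) := by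
  rw [vec_apply, Finset.sum_mul]
  simp only [smul_mul_assoc, constVec_mul hg ha]
  rw [Matrix.mulVec_eq_sum, map_sum, Finset.mul_sum]
  refine Finset.sum_congr rfl fun m _ => ?_
  rw [op_smul_eq_smul, map_smul, mul_smul_comm]

theorem adMat_inverse_mul (hg : constantCoeff g = 1) :
    adMat b (Ring.inverse g) * adMat b g = 1 := by
  rw [← map_mul, Ring.inverse_mul_cancel _ (isUnit_of_constantCoeff_eq_one hg), map_one]

theorem adMat_mul_inverse (hg : constantCoeff g = 1) :
    adMat b g * adMat b (Ring.inverse g) = 1 := by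
  rw [← map_mul, Ring.mul_inverse_cancel _ (isUnit_of_constantCoeff_eq_one hg), map_one]

theorem HasLogDeriv.mul [CharZero k] (hh : HasLogDeriv b h a') (hg : constantCoeff g = 1)
    (ha : HasLogDeriv b g a) :
    HasLogDeriv b (h * g) (a + a' * (adMat b (Ring.inverse g))ᵀ) := fun i => by
  have : (a + a' * (adMat b (Ring.inverse g))ᵀ) i =
      a i + adMat b (Ring.inverse g) *ᵥ a' i := by
    funext m
    rw [← Matrix.vecMul_transpose]
    rfl
  rw [partialDeriv_mul, hh, ha, mul_assoc, vec_mul hg ha, this, map_add]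
  noncomm_ring

theorem HasLogDeriv.inverse [CharZero k] (hg : constantCoeff g = 1) (ha : HasLogDeriv b g a) :
    HasLogDeriv b (Ring.inverse g) (-(a * (adMat b g)ᵀ)) := fun i => by
  have hu := isUnit_of_constantCoeff_eq_one hg
  have h1 := vec_mul hg ha (adMat b g *ᵥ a i)
  rw [Matrix.mulVec_mulVec, adMat_inverse_mul hg, Matrix.one_mulVec] at h1
  have h2 : (-(a * (adMat b g)ᵀ)) i = -(adMat b g *ᵥ a i) := by
    funext m
    rw [← Matrix.vecMul_transpose]
    rfl
  rw [partialDeriv_inverse hg ha, h2, map_neg, mul_neg]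
  congr 1
  have h3 := congrArg (fun t => Ring.inverse g * t * Ring.inverse g) h1
  simp only [mul_assoc, Ring.mul_inverse_cancel _ hu, mul_one] at h3
  rw [h3, Ring.inverse_mul_cancel_left _ _ hu]

/-- The Jacobian matrix `∂θ_j / ∂lam_i` of a formal map. -/
def jacobian (θ : I → MvPowerSeries I k) : Matrix I I (MvPowerSeries I k) :=
  Matrix.of fun i j => partialDeriv i (θ j)

omit [DecidableEq I] in
theorem HasLogDeriv.compose {θ : I → MvPowerSeries I k} (hθ : ∀ j, constantCoeff (θ j) = 0)
    (ha : HasLogDeriv b g a) :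
    HasLogDeriv b (compose g θ) (jacobian θ * a.map fun r => FormalMaps.compose r θ) := fun i => by
  rw [partialDeriv_compose hθ]
  have h1 : (jacobian θ * a.map fun r => FormalMaps.compose r θ) i =
      ∑ j, partialDeriv i (θ j) • fun m => FormalMaps.compose (a j m) θ := by
    funext m
    simp [Matrix.mul_apply, jacobian]
  rw [h1, map_sum, Finset.mul_sum]
  refine Finset.sum_congr rfl fun j _ => ?_
  rw [ha, compose_mul hθ, compose_vec b hθ, map_smul, mul_smul_comm]
  rfl

/-! ### The coadjoint substitution -/

theorem coadjointMap_apply (g : MvPowerSeries I (UniversalEnvelopingAlgebra k 𝔤)) (j : I) :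
    coadjointMap b g j = ∑ m, adMat b (Ring.inverse g) m j * X m := by
  rw [coadjointMap, pairing]
  refine Finset.sum_congr rfl fun m _ => ?_
  congr 1
  ext d
  rw [coeff_adMat, adRep_apply]
  rfl

theorem constantCoeff_coadjointMap (g : MvPowerSeries I (UniversalEnvelopingAlgebra k 𝔤)) (j : I) :
    constantCoeff (coadjointMap b g j) = 0 := by
  rw [coadjointMap_apply, map_sum]
  exact Finset.sum_eq_zero fun m _ => by rw [map_mul, constantCoeff_X, mul_zero]

theorem coadjointMap_one : coadjointMap b (1 : MvPowerSeries I (UniversalEnvelopingAlgebra k 𝔤)) =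
    X := by
  funext j
  rw [coadjointMap_apply, Ring.inverse_one, map_one, Finset.sum_eq_single j]
  · simp
  · intro m _ hm
    simp [hm]
  · simp

theorem ordGE_coadjointMap_sub_X (hg : constantCoeff g = 1) (j : I) :
    OrdGE 2 (coadjointMap b g j - X j) := by
  have h1 : coadjointMap b g j - X j =
      ∑ m, (adMat b (Ring.inverse g) - 1) m j * X m := by
    rw [coadjointMap_apply]
    simp only [Matrix.sub_apply, sub_mul, Finset.sum_sub_distrib, Matrix.one_apply, ite_mul,
      one_mul, zero_mul, Finset.sum_ite_eq', Finset.mem_univ, if_true]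
  rw [h1]
  refine OrdGE.sum fun m _ => OrdGE.mul (m := 1) (n := 1) ?_ (OrdGE.one_iff.2 (constantCoeff_X m))
  rw [OrdGE.one_iff, Matrix.sub_apply, map_sub, constantCoeff_adMat_inverse hg]
  by_cases h : m = j <;> simp [h, Matrix.one_apply]

omit [DecidableEq I] in
theorem inverse_compose {θ : I → MvPowerSeries I k} (hθ : ∀ j, constantCoeff (θ j) = 0)
    (hg : constantCoeff g = 1) : Ring.inverse (compose g θ) = compose (Ring.inverse g) θ := by
  have hu := isUnit_of_constantCoeff_eq_one hg
  apply inverse_eq_of_mul_eq_one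
  · rw [← compose_mul hθ, Ring.mul_inverse_cancel _ hu, ← composeHom_apply hθ, map_one]
  · rw [← compose_mul hθ, Ring.inverse_mul_cancel _ hu, ← composeHom_apply hθ, map_one]

omit [Fintype I] [DecidableEq I] in
theorem inverse_mul (hg : constantCoeff g = 1) (hh : constantCoeff h = 1) :
    Ring.inverse (g * h) = Ring.inverse h * Ring.inverse g := by
  have hu := isUnit_of_constantCoeff_eq_one hg
  have hu' := isUnit_of_constantCoeff_eq_one hh
  apply inverse_eq_of_mul_eq_one
  · rw [mul_assoc, Ring.mul_inverse_cancel_left _ _ hu', Ring.mul_inverse_cancel _ hu]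
  · rw [mul_assoc, Ring.inverse_mul_cancel_left _ _ hu, Ring.inverse_mul_cancel _ hu']

/-- `Ad* ((g * h) (lam)) lam = Ad* (h (lam')) lam'` for `lam' = Ad* (g (lam)) lam`. -/
theorem coadjointMap_mapMul (hg : constantCoeff g = 1) (hh : constantCoeff h = 1) (j : I) :
    coadjointMap b (mapMul b g h) j = compose (coadjointMap b h j) (coadjointMap b g) := by
  have hθ := constantCoeff_coadjointMap (b := b) g
  have h1 : compose (coadjointMap b h j) (coadjointMap b g) =
      ∑ n, adMat b (compose (Ring.inverse h) (coadjointMap b g)) n j * coadjointMap b g n := by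
    rw [coadjointMap_apply, ← composeHom_apply hθ, map_sum]
    refine Finset.sum_congr rfl fun n _ => ?_
    rw [map_mul, composeHom_apply, composeHom_apply, compose_X hθ, scal_self, compose_adMat b hθ]
  rw [h1, coadjointMap_apply, mapMul, inverse_mul (by rw [constantCoeff_compose hθ, hh]) hg,
    inverse_compose hθ hh, map_mul]
  simp only [Matrix.mul_apply, coadjointMap_apply, Finset.sum_mul, Finset.mul_sum]
  rw [Finset.sum_comm]
  refine Finset.sum_congr rfl fun n _ => Finset.sum_congr rfl fun m _ => ?_
  ring

end Adjoint

/-! ### The group of formal maps -/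

section GroupStructure

open MvPowerSeries

variable {k 𝔤 I : Type*} [Field k] [CharZero k] [LieRing 𝔤] [LieAlgebra k 𝔤] [Fintype I]
  (b : Module.Basis I k 𝔤) {g h f : MvPowerSeries I (UniversalEnvelopingAlgebra k 𝔤)}

omit [CharZero k] [Fintype I] in
theorem constantCoeff_of_mem_map0 (hg : g ∈ map0 k 𝔤 I) : constantCoeff g = 1 := by
  obtain ⟨x, -, hx, rfl⟩ := hg
  exact constantCoeff_formalExp (OrdGE.one_iff.2 hx)

include b in
theorem one_mem_map0 : (1 : MvPowerSeries I (UniversalEnvelopingAlgebra k 𝔤)) ∈ map0 k 𝔤 I := by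
  rw [mem_map0_iff b]
  exact ⟨map_one _, 0, fun i => by
    rw [partialDeriv_one, one_mul]; exact (map_zero (vec b)).symm⟩

theorem mapMul_mem_map0 (hg : g ∈ map0 k 𝔤 I) (hh : h ∈ map0 k 𝔤 I) :
    mapMul b g h ∈ map0 k 𝔤 I := by
  classical
  rw [mem_map0_iff b] at hg hh ⊢
  obtain ⟨hg0, a, ha⟩ := hg
  obtain ⟨hh0, a', ha'⟩ := hh
  have hθ := constantCoeff_coadjointMap (b := b) g
  exact ⟨by rw [mapMul, map_mul, constantCoeff_compose hθ, hg0, hh0, one_mul],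
    _, (ha'.compose hθ).mul hg0 ha⟩

omit [CharZero k] in
theorem mapMul_assoc (hg : constantCoeff g = 1) (hh : constantCoeff h = 1) :
    mapMul b (mapMul b g h) f = mapMul b g (mapMul b h f) := by
  classical
  have hθ := constantCoeff_coadjointMap (b := b) g
  rw [mapMul, funext (coadjointMap_mapMul hg hh),
    ← compose_compose (constantCoeff_coadjointMap h) hθ]
  simp only [mapMul]
  rw [compose_mul hθ, mul_assoc]

omit [CharZero k] in
theorem mapMul_one : mapMul b g 1 = g := by
  classical
  rw [mapMul, ← composeHom_apply (constantCoeff_coadjointMap g), map_one, one_mul]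

theorem exists_mapMul_eq_one (hg : g ∈ map0 k 𝔤 I) :
    ∃ h ∈ map0 k 𝔤 I, mapMul b g h = 1 := by
  classical
  rw [mem_map0_iff b] at hg
  obtain ⟨hg0, a, ha⟩ := hg
  have hθ := constantCoeff_coadjointMap (b := b) g
  obtain ⟨ψ, hψ0, hψ⟩ := exists_compose_eq_X (ordGE_coadjointMap_sub_X (b := b) hg0)
  refine ⟨compose (Ring.inverse g) ψ, ?_, ?_⟩
  · rw [mem_map0_iff b]
    exact ⟨by rw [constantCoeff_compose hψ0, constantCoeff_inverse hg0],
      _, (ha.inverse hg0).compose hψ0⟩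
  · rw [mapMul, compose_compose hψ0 hθ, funext hψ, compose_X_right,
      Ring.inverse_mul_cancel _ (isUnit_of_constantCoeff_eq_one hg0)]

/-- The group of formal maps `g : 𝔤* → G` with `g (0) = 1`. -/
abbrev map0Group : Group (map0 k 𝔤 I) :=
  letI : Mul (map0 k 𝔤 I) := ⟨fun g h => ⟨mapMul b g h, mapMul_mem_map0 b g.2 h.2⟩⟩
  letI : One (map0 k 𝔤 I) := ⟨⟨1, one_mem_map0 b⟩⟩
  letI : Inv (map0 k 𝔤 I) := ⟨fun g => ⟨(exists_mapMul_eq_one b g.2).choose,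
    (exists_mapMul_eq_one b g.2).choose_spec.1⟩⟩
  Group.ofRightAxioms
    (fun g h _ => Subtype.ext
      (mapMul_assoc b (constantCoeff_of_mem_map0 g.2) (constantCoeff_of_mem_map0 h.2)))
    (fun _ => Subtype.ext (mapMul_one b))
    (fun g => Subtype.ext (exists_mapMul_eq_one b g.2).choose_spec.2)

end GroupStructure

/-! ### Formal functions with values in the tensor square -/

section Hamiltonian

open MvPowerSeries Matrix

variable {k 𝔤 I : Type*} [Field k] [LieRing 𝔤] [LieAlgebra k 𝔤]

/-- `(U(𝔤) ⊗ U(𝔤))⟦lam_i⟧` is an algebra over its central subring `k⟦lam_i⟧`. -/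
instance instAlgebraFormalTensor : Algebra (MvPowerSeries I k) (MvPowerSeries I
    (UniversalEnvelopingAlgebra k 𝔤 ⊗[k] UniversalEnvelopingAlgebra k 𝔤)) :=
  RingHom.toAlgebra' scal fun r f => scal_commute r f

theorem smul_eq_scal_mul_tensor (r : MvPowerSeries I k) (f : MvPowerSeries I
    (UniversalEnvelopingAlgebra k 𝔤 ⊗[k] UniversalEnvelopingAlgebra k 𝔤)) :
    r • f = scal r * f := rfl

theorem inFst_smul (r : MvPowerSeries I k)
    (f : MvPowerSeries I (UniversalEnvelopingAlgebra k 𝔤)) : inFst (r • f) = r • inFst f := by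
  rw [smul_eq_scal_mul, smul_eq_scal_mul_tensor, map_mul]
  congr 1

theorem inSnd_smul (r : MvPowerSeries I k)
    (f : MvPowerSeries I (UniversalEnvelopingAlgebra k 𝔤)) : inSnd (r • f) = r • inSnd f := by
  rw [smul_eq_scal_mul, smul_eq_scal_mul_tensor, map_mul]
  congr 1
  ext d
  simp only [inSnd, coeff_map]
  exact AlgHom.commutes (Algebra.TensorProduct.includeRight (R := k)
    (A := UniversalEnvelopingAlgebra k 𝔤) (B := UniversalEnvelopingAlgebra k 𝔤)) _

theorem inFst_inSnd_commute (f g : MvPowerSeries I (UniversalEnvelopingAlgebra k 𝔤)) :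
    Commute (inFst f) (inSnd g) := by
  classical
  ext d
  rw [coeff_mul, coeff_mul, Finsupp.sum_antidiagonal_swap d fun a b =>
    coeff a (inSnd g) * coeff b (inFst f)]
  refine Finset.sum_congr rfl fun p _ => ?_
  simp only [inFst, inSnd, coeff_map]
  change (_ ⊗ₜ[k] _) * (_ ⊗ₜ[k] _) = (_ ⊗ₜ[k] _) * (_ ⊗ₜ[k] _)
  simp only [Algebra.TensorProduct.tmul_mul_tmul, one_mul, mul_one]

variable [Fintype I]

theorem compose_inFst {θ : I → MvPowerSeries I k} (hθ : ∀ j, constantCoeff (θ j) = 0)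
    (f : MvPowerSeries I (UniversalEnvelopingAlgebra k 𝔤)) :
    compose (inFst f) θ = inFst (compose f θ) :=
  compose_map hθ (Algebra.TensorProduct.includeLeft (R := k) (S := k)
    (A := UniversalEnvelopingAlgebra k 𝔤) (B := UniversalEnvelopingAlgebra k 𝔤)) f

theorem compose_inSnd {θ : I → MvPowerSeries I k} (hθ : ∀ j, constantCoeff (θ j) = 0)
    (f : MvPowerSeries I (UniversalEnvelopingAlgebra k 𝔤)) :
    compose (inSnd f) θ = inSnd (compose f θ) :=
  compose_map hθ (Algebra.TensorProduct.includeRight (R := k)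
    (A := UniversalEnvelopingAlgebra k 𝔤) (B := UniversalEnvelopingAlgebra k 𝔤)) f

variable (b : Module.Basis I k 𝔤)

/-- The formal function `∑ p q, Z_{pq} e_p ⊗ e_q` with values in `𝔤 ⊗ 𝔤`, inside
`(U(𝔤) ⊗ U(𝔤))⟦lam_i⟧`. -/
def tensorVec : Matrix I I (MvPowerSeries I k) →ₗ[MvPowerSeries I k] MvPowerSeries I
    (UniversalEnvelopingAlgebra k 𝔤 ⊗[k] UniversalEnvelopingAlgebra k 𝔤) where
  toFun Z := ∑ p, ∑ q, Z p q • (inFst (constVec (b p)) * inSnd (constVec (b q)))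
  map_add' Z Z' := by simp only [Matrix.add_apply, add_smul, Finset.sum_add_distrib]
  map_smul' r Z := by
    simp only [Matrix.smul_apply, smul_eq_mul, mul_smul, Finset.smul_sum, RingHom.id_apply]

theorem tensorVec_apply (Z : Matrix I I (MvPowerSeries I k)) :
    tensorVec b Z = ∑ p, ∑ q, Z p q • (inFst (constVec (b p)) * inSnd (constVec (b q))) := rfl

theorem inFst_vec (c : I → MvPowerSeries I k) :
    inFst (vec b c) = ∑ p, c p • inFst (constVec (b p)) := by
  simp only [vec_apply, map_sum, inFst_smul]

theorem inSnd_vec (c : I → MvPowerSeries I k) :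
    inSnd (vec b c) = ∑ p, c p • inSnd (constVec (b p)) := by
  simp only [vec_apply, map_sum, inSnd_smul]

theorem tensorVec_vecMulVec (c c' : I → MvPowerSeries I k) :
    tensorVec b (vecMulVec c c') = inFst (vec b c) * inSnd (vec b c') := by
  rw [inFst_vec, inSnd_vec, Finset.sum_mul_sum, tensorVec_apply]
  refine Finset.sum_congr rfl fun p _ => Finset.sum_congr rfl fun q _ => ?_
  rw [vecMulVec_apply, smul_mul_smul_comm]

theorem tensorVec_mul (Y Z : Matrix I I (MvPowerSeries I k)) :
    tensorVec b (Y * Z) = ∑ r, inFst (vec b (Yᵀ r)) * inSnd (vec b (Z r)) := by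
  have : Y * Z = ∑ r, vecMulVec (Yᵀ r) (Z r) := by
    ext1 p q
    simp only [Matrix.mul_apply, Matrix.sum_apply, vecMulVec_apply, transpose_apply]
  rw [this, map_sum]
  simp only [tensorVec_vecMulVec]

theorem compose_tensorVec {θ : I → MvPowerSeries I k} (hθ : ∀ j, constantCoeff (θ j) = 0)
    (Z : Matrix I I (MvPowerSeries I k)) :
    compose (tensorVec b Z) θ = tensorVec b (Z.map fun r => compose r θ) := by
  simp only [tensorVec_apply, ← composeHom_apply hθ, map_sum, smul_eq_scal_mul_tensor, map_mul]
  refine Finset.sum_congr rfl fun p _ => Finset.sum_congr rfl fun q _ => ?_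
  rw [composeHom_apply, composeHom_apply, composeHom_apply, compose_scal hθ, compose_inFst hθ,
    compose_inSnd hθ, constVec, constVec, compose_C hθ, compose_C hθ]
  rfl

theorem tensorVec_transpose_eq_zero {Z : Matrix I I (MvPowerSeries I k)}
    (hZ : tensorVec b Z = 0) : tensorVec b Zᵀ = 0 := by
  let φ := (Algebra.TensorProduct.comm k (UniversalEnvelopingAlgebra k 𝔤)
    (UniversalEnvelopingAlgebra k 𝔤)).toAlgHom
  let F : MvPowerSeries I (UniversalEnvelopingAlgebra k 𝔤 ⊗[k] UniversalEnvelopingAlgebra k 𝔤) →+*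
    MvPowerSeries I (UniversalEnvelopingAlgebra k 𝔤 ⊗[k] UniversalEnvelopingAlgebra k 𝔤) :=
    MvPowerSeries.map (φ : _ →+* _)
  have h1 : ∀ f : MvPowerSeries I (UniversalEnvelopingAlgebra k 𝔤), F (inFst f) = inSnd f :=
    fun f => by ext d; simp [F, φ, inFst, inSnd]
  have h2 : ∀ f : MvPowerSeries I (UniversalEnvelopingAlgebra k 𝔤), F (inSnd f) = inFst f :=
    fun f => by ext d; simp [F, φ, inFst, inSnd]
  have h3 : ∀ r : MvPowerSeries I k, F (scal r) = scal r := fun r => by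
    ext d
    simp only [F, coeff_map]
    exact φ.commutes _
  have h4 : F (tensorVec b Z) = tensorVec b Zᵀ := by
    simp only [tensorVec_apply, map_sum, smul_eq_scal_mul_tensor, map_mul, h1, h2, h3]
    rw [Finset.sum_comm]
    refine Finset.sum_congr rfl fun p _ => Finset.sum_congr rfl fun q _ => ?_
    rw [transpose_apply, (inFst_inSnd_commute _ _).eq]
  rw [← h4, hZ, map_zero]

/-! ### The Kirillov–Kostant–Souriau bivector -/

/-- The matrix `⟨lam, [e_i, e_j]⟩` of the linear Poisson structure on `𝔤*`. -/
def kks : Matrix I I (MvPowerSeries I k) :=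
  Matrix.of fun i j => ∑ m, C (b.repr ⁅b i, b j⁆ m) * X m

theorem kks_apply (i j : I) : kks b i j = ∑ m, C (b.repr ⁅b i, b j⁆ m) * X m := rfl

theorem kks_transpose : (kks b)ᵀ = -kks b := by
  ext1 i j
  simp only [transpose_apply, Matrix.neg_apply, kks_apply, ← Finset.sum_neg_distrib, ← neg_mul,
    ← map_neg, ← Finsupp.neg_apply, lie_skew]

variable [DecidableEq I]

theorem sum_adMat_vec_mul_X (c : I → MvPowerSeries I k) (j : I) :
    ∑ m, X m * adMat b (vec b c) m j = (c ᵥ* kks b) j := by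
  simp only [adMat_vec, Finset.mul_sum, Matrix.vecMul, dotProduct, kks_apply]
  rw [Finset.sum_comm]
  refine Finset.sum_congr rfl fun p _ => Finset.sum_congr rfl fun m _ => ?_
  ring

/-- The kernel of `𝔤 → U(𝔤)` is central, so contracting an element of `𝔤 ⊗ 𝔤` which vanishes in
`U(𝔤) ⊗ U(𝔤)` with the Poisson bivector gives a vector which vanishes in `U(𝔤)`. -/
theorem vec_mul_kks_eq_zero {Z : Matrix I I (MvPowerSeries I k)} (hZ : tensorVec b Z = 0) (r : I) :
    vec b ((Z * kks b)ᵀ r) = 0 := by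
  have h1 : ∀ m, vec b (fun p => ∑ q, Z p q * C (b.repr ⁅b q, b r⁆ m)) = 0 := by
    intro m
    -- `u ↦ ⟨ε^m, u · e_r⟩` for the adjoint action, so that `e_q ↦ ⟨ε^m, [e_q, e_r]⟩`.
    let f : UniversalEnvelopingAlgebra k 𝔤 →ₗ[k] k :=
      (Matrix.entryLinearMap k k m r) ∘ₗ (adRep b).toLinearMap
    let Ψ : UniversalEnvelopingAlgebra k 𝔤 ⊗[k] UniversalEnvelopingAlgebra k 𝔤 →ₗ[k]
        UniversalEnvelopingAlgebra k 𝔤 :=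
      (TensorProduct.rid k _).toLinearMap ∘ₗ f.lTensor _
    have hf : ∀ v, f (UniversalEnvelopingAlgebra.ι k v) = b.repr ⁅v, b r⁆ m := fun v =>
      adRep_ι b v m r
    ext d
    have h2 := congrArg (fun t => Ψ (coeff d t)) hZ
    simp only [tensorVec_apply, map_sum, map_zero] at h2
    have h3 : ∀ p q, Ψ (coeff d (Z p q • (inFst (constVec (b p)) * inSnd (constVec (b q))))) =
        (coeff d (Z p q) * b.repr ⁅b q, b r⁆ m) • UniversalEnvelopingAlgebra.ι k (b p) := by
      intro p q
      have h4 : inFst (constVec (b p)) * inSnd (constVec (b q)) = (C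
          (UniversalEnvelopingAlgebra.ι k (b p) ⊗ₜ[k] UniversalEnvelopingAlgebra.ι k (b q)) :
          MvPowerSeries I (UniversalEnvelopingAlgebra k 𝔤 ⊗[k] UniversalEnvelopingAlgebra k 𝔤)) := by
        simp only [inFst, inSnd, constVec, map_C, ← map_mul]
        congr 1
        change (_ ⊗ₜ[k] _) * (_ ⊗ₜ[k] _) = _
        rw [Algebra.TensorProduct.tmul_mul_tmul, one_mul, mul_one]
      rw [smul_eq_scal_mul_tensor, h4, coeff_mul_C, coeff_map, ← Algebra.smul_def, map_smul,
        mul_smul]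
      congr 1
      simp only [Ψ, LinearMap.comp_apply, LinearMap.lTensor_tmul, hf, LinearEquiv.coe_coe,
        TensorProduct.rid_tmul]
    simp only [h3] at h2
    rw [coeff_vec, map_sum, coeff_zero, ← h2]
    refine Finset.sum_congr rfl fun p _ => ?_
    rw [map_sum, map_smul, ← Finset.sum_smul]
    simp only [coeff_mul_C]
  have h5 : (Z * kks b)ᵀ r = ∑ m, (X m : MvPowerSeries I k) •
      fun p => ∑ q, Z p q * C (b.repr ⁅b q, b r⁆ m) := by
    funext p
    simp only [transpose_apply, Matrix.mul_apply, kks_apply, Finset.sum_apply, Pi.smul_apply,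
      smul_eq_mul, Finset.mul_sum]
    rw [Finset.sum_comm]
    refine Finset.sum_congr rfl fun m _ => Finset.sum_congr rfl fun q _ => ?_
    ring
  rw [h5, map_sum]
  simp only [map_smul, h1, smul_zero, Finset.sum_const_zero]

theorem tensorVec_mul_kks_mul_eq_zero {Z : Matrix I I (MvPowerSeries I k)}
    (hZ : tensorVec b Z = 0) (Y : Matrix I I (MvPowerSeries I k)) :
    tensorVec b (Z * kks b * Y) = 0 := by
  rw [tensorVec_mul]
  refine Finset.sum_eq_zero fun r _ => ?_
  rw [vec_mul_kks_eq_zero b hZ, map_zero, zero_mul]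

theorem tensorVec_mul_kks_mul_eq_zero' {Z : Matrix I I (MvPowerSeries I k)}
    (hZ : tensorVec b Z = 0) (Y : Matrix I I (MvPowerSeries I k)) :
    tensorVec b (Y * kks b * Z) = 0 := by
  have h := tensorVec_transpose_eq_zero b
    (tensorVec_mul_kks_mul_eq_zero b (tensorVec_transpose_eq_zero b hZ) (-Yᵀ))
  convert h using 2
  simp only [transpose_mul, transpose_neg, transpose_transpose, kks_transpose, neg_mul_neg,
    Matrix.mul_assoc]

/-! ### The Hamiltonian condition in matrix form -/

/-- The matrix `aᵀ - a - aᵀ π a`, whose vanishing in `𝔤 ⊗ 𝔤` is the Hamiltonian condition. -/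
def hamMatrix (π a : Matrix I I (MvPowerSeries I k)) : Matrix I I (MvPowerSeries I k) :=
  aᵀ - a - aᵀ * π * a

theorem isHamiltonian_iff {g : MvPowerSeries I (UniversalEnvelopingAlgebra k 𝔤)}
    {a : Matrix I I (MvPowerSeries I k)} (hg : constantCoeff g = 1) (ha : HasLogDeriv b g a) :
    IsHamiltonian b g ↔ tensorVec b (hamMatrix (kks b) a) = 0 := by
  have h0 : ∀ i, leftLogDeriv g i = vec b (a i) := fun i => by
    rw [leftLogDeriv, ha, Ring.inverse_mul_cancel_left _ _ (isUnit_of_constantCoeff_eq_one hg)]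
  have h1 : d₂g₁ b g = tensorVec b aᵀ := by
    rw [← Matrix.mul_one aᵀ, tensorVec_mul, d₂g₁]
    refine Finset.sum_congr rfl fun i _ => ?_
    rw [h0, ← vec_single, transpose_transpose]
    congr 3
    funext j
    rw [Matrix.one_apply, Pi.single_apply]
    simp only [eq_comm]
  have h2 : d₁g₂ b g = tensorVec b a := by
    rw [← Matrix.one_mul a, tensorVec_mul, d₁g₂]
    refine Finset.sum_congr rfl fun i _ => ?_
    rw [h0, ← vec_single]
    congr 3
    funext j
    rw [Matrix.transpose_apply, Matrix.one_apply, Pi.single_apply]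
  have h3 : bracketTerm b g = tensorVec b (aᵀ * kks b * a) := by
    have h4 : ∀ (c : k) (m : I) (t : MvPowerSeries I
        (UniversalEnvelopingAlgebra k 𝔤 ⊗[k] UniversalEnvelopingAlgebra k 𝔤)),
        c • (X m * t) = (C c * X m : MvPowerSeries I k) • t := by
      intro c m t
      rw [smul_eq_scal_mul_tensor, map_mul, map_X, map_C, mul_assoc]
      ext d
      rw [coeff_C_mul, ← Algebra.smul_def]
      rfl
    have h5 : aᵀ * kks b * a = ∑ i, ∑ j, kks b i j • vecMulVec (a i) (a j) := by
      ext1 p q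
      simp only [Matrix.mul_apply, Matrix.sum_apply, Matrix.smul_apply, vecMulVec_apply,
        transpose_apply, smul_eq_mul, Finset.sum_mul]
      rw [Finset.sum_comm]
      refine Finset.sum_congr rfl fun i _ => Finset.sum_congr rfl fun j _ => ?_
      ring
    rw [h5, bracketTerm, map_sum]
    refine Finset.sum_congr rfl fun i _ => ?_
    rw [map_sum]
    refine Finset.sum_congr rfl fun j _ => ?_
    rw [map_smul, tensorVec_vecMulVec, kks_apply, Finset.sum_smul]
    refine Finset.sum_congr rfl fun m _ => ?_
    rw [h4, h0, h0]
  rw [IsHamiltonian, h1, h2, h3, hamMatrix, map_sub, map_sub]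

theorem hamMatrix_add_mul {π : Matrix I I (MvPowerSeries I k)}
    (hπ : πᵀ = -π) (a β : Matrix I I (MvPowerSeries I k)) :
    hamMatrix π (a + (1 - a * π) * β) = hamMatrix π a + hamMatrix π β
      + βᵀ * π * hamMatrix π a - hamMatrix π a * π * β - βᵀ * π * (hamMatrix π a * π * β) := by
  simp only [hamMatrix, transpose_add, transpose_mul, transpose_sub, transpose_one, hπ]
  noncomm_ring

omit [DecidableEq I] in
theorem hamMatrix_conj (M π a : Matrix I I (MvPowerSeries I k)) :
    hamMatrix π (M * a * Mᵀ) = M * hamMatrix (Mᵀ * π * M) a * Mᵀ := by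
  simp only [hamMatrix, transpose_mul, transpose_transpose, Matrix.mul_sub, Matrix.sub_mul,
    Matrix.mul_assoc]

variable [CharZero k] {b} {g h : MvPowerSeries I (UniversalEnvelopingAlgebra k 𝔤)}
  {a a' : Matrix I I (MvPowerSeries I k)}

/-- The coadjoint action preserves the linear Poisson structure: `Mᵀ π M = π ∘ θ_g`. -/
theorem kks_conj (hg : constantCoeff g = 1) (ha : HasLogDeriv b g a) :
    (adMat b (Ring.inverse g))ᵀ * kks b * adMat b (Ring.inverse g) =
      (kks b).map fun r => compose r (coadjointMap b g) := by
  have hθ := constantCoeff_coadjointMap (b := b) g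
  set M := adMat b (Ring.inverse g) with hM
  have h1 : ∀ i, adMat b (vec b (Mᵀ i)) * M = M * adMat b (constVec (b i)) := by
    intro i
    have := congrArg (adMat b) (constVec_mul hg ha i)
    rw [map_mul, map_mul] at this
    have h2 := congrArg (fun t => M * t * M) this
    simp only [Matrix.mul_assoc] at h2
    rw [adMat_mul_inverse hg, Matrix.mul_one, ← Matrix.mul_assoc M, adMat_inverse_mul hg,
      Matrix.one_mul] at h2
    exact h2.symm
  ext1 i j
  have h3 : (Mᵀ * kks b * M) i j = ∑ m, X m * (adMat b (vec b (Mᵀ i)) * M) m j := by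
    have : (Mᵀ * kks b) i = Mᵀ i ᵥ* kks b := rfl
    rw [Matrix.mul_apply, this]
    simp only [← sum_adMat_vec_mul_X, Matrix.mul_apply, Finset.sum_mul, Finset.mul_sum]
    rw [Finset.sum_comm]
    simp only [mul_assoc]
  rw [h3, h1, Matrix.map_apply, kks_apply, ← composeHom_apply hθ, map_sum]
  simp only [map_mul, composeHom_apply, compose_C hθ, compose_X hθ, scal_self, coadjointMap_apply,
    Matrix.mul_apply, adMat_constVec, Finset.mul_sum]
  rw [Finset.sum_comm]
  refine Finset.sum_congr rfl fun n _ => Finset.sum_congr rfl fun m _ => ?_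
  rw [← hM]
  ring

omit [CharZero k] in
/-- The derivative of the coadjoint substitution: `∂θ_g = (1 - a π) M`. -/
theorem jacobian_coadjointMap (hg : constantCoeff g = 1) (ha : HasLogDeriv b g a) :
    jacobian (coadjointMap b g) = (1 - a * kks b) * adMat b (Ring.inverse g) := by
  set M := adMat b (Ring.inverse g) with hM
  ext1 i j
  have h1 : (a * kks b) i = a i ᵥ* kks b := rfl
  rw [jacobian, Matrix.of_apply, coadjointMap_apply, partialDeriv_sum, Matrix.sub_mul,
    Matrix.one_mul, Matrix.sub_apply, Matrix.mul_apply, h1]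
  simp only [partialDeriv_mul, Finset.sum_add_distrib, ← hM]
  rw [add_comm, sub_eq_add_neg]
  congr 1
  · rw [Finset.sum_eq_single i, partialDeriv_X_self, mul_one]
    · intro m _ hm
      rw [partialDeriv_X_of_ne hm.symm, mul_zero]
    · simp
  · simp only [hM, partialDeriv_adMat_inverse hg ha, ← sum_adMat_vec_mul_X,
      Matrix.mul_apply, neg_mul, Finset.sum_neg_distrib, Finset.sum_mul]
    rw [neg_inj, Finset.sum_comm]
    refine Finset.sum_congr rfl fun q _ => Finset.sum_congr rfl fun m _ => ?_
    ring

/-- Conjugation by `g ⊗ g` acts on `𝔤 ⊗ 𝔤` through `Ad g`. -/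
theorem tensorVec_conj_eq_zero_iff (hg : constantCoeff g = 1) (ha : HasLogDeriv b g a)
    (Z : Matrix I I (MvPowerSeries I k)) :
    tensorVec b (adMat b (Ring.inverse g) * Z * (adMat b (Ring.inverse g))ᵀ) = 0 ↔
      tensorVec b Z = 0 := by
  have hu := isUnit_of_constantCoeff_eq_one hg
  set M := adMat b (Ring.inverse g) with hM
  have hW : IsUnit (inFst g * inSnd g) := (hu.map inFst).mul (hu.map inSnd)
  have h1 : M * Z * Mᵀ = ∑ p, ∑ q, Z p q • vecMulVec (Mᵀ p) (Mᵀ q) := by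
    ext1 i j
    simp only [Matrix.mul_apply, Matrix.sum_apply, Matrix.smul_apply, vecMulVec_apply,
      transpose_apply, smul_eq_mul, Finset.sum_mul]
    rw [Finset.sum_comm]
    refine Finset.sum_congr rfl fun p _ => Finset.sum_congr rfl fun q _ => ?_
    ring
  have h2 : tensorVec b Z * (inFst g * inSnd g) =
      (inFst g * inSnd g) * tensorVec b (M * Z * Mᵀ) := by
    rw [h1, tensorVec_apply]
    simp only [map_sum, Finset.sum_mul, Finset.mul_sum, map_smul, smul_mul_assoc, mul_smul_comm,
      tensorVec_vecMulVec]
    refine Finset.sum_congr rfl fun p _ => Finset.sum_congr rfl fun q _ => ?_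
    congr 1
    calc inFst (constVec (b p)) * inSnd (constVec (b q)) * (inFst g * inSnd g)
        = inFst (constVec (b p)) * (inFst g * inSnd (constVec (b q))) * inSnd g := by
          rw [(inFst_inSnd_commute g (constVec (b q))).eq]; simp only [mul_assoc]
      _ = inFst (constVec (b p) * g) * inSnd (constVec (b q) * g) := by
          simp only [map_mul, mul_assoc]
      _ = inFst g * (inFst (vec b (Mᵀ p)) * inSnd g) * inSnd (vec b (Mᵀ q)) := by
          rw [constVec_mul hg ha, constVec_mul hg ha]; simp only [map_mul, mul_assoc]; rfl
      _ = inFst g * inSnd g * (inFst (vec b (Mᵀ p)) * inSnd (vec b (Mᵀ q))) := by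
          rw [(inFst_inSnd_commute _ g).eq]; simp only [mul_assoc]
  constructor
  · intro h
    rw [h, mul_zero] at h2
    exact hW.mul_left_eq_zero.1 h2
  · intro h
    rw [h, zero_mul] at h2
    exact hW.mul_right_eq_zero.1 h2.symm

/-- If `g` is Hamiltonian, then `g * h` is Hamiltonian if and only if `h` is. -/
theorem isHamiltonian_mapMul_iff (hg : constantCoeff g = 1) (ha : HasLogDeriv b g a)
    (hh : constantCoeff h = 1) (ha' : HasLogDeriv b h a') (hgham : IsHamiltonian b g)
    {χ : I → MvPowerSeries I k} (hχ : ∀ j, constantCoeff (χ j) = 0)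
    (hgχ : ∀ j, compose (coadjointMap b g j) χ = X j) :
    IsHamiltonian b (mapMul b g h) ↔ IsHamiltonian b h := by
  have hθ := constantCoeff_coadjointMap (b := b) g
  set θ := coadjointMap b g with hθ'
  set M := adMat b (Ring.inverse g) with hM
  set aθ := a'.map fun r => compose r θ with haθ
  rw [isHamiltonian_iff b hg ha] at hgham
  have h1 : a + jacobian θ * aθ * Mᵀ = a + (1 - a * kks b) * (M * aθ * Mᵀ) := by
    rw [hθ', jacobian_coadjointMap hg ha, ← hM]
    simp only [Matrix.mul_assoc]
  have h2 : hamMatrix ((kks b).map fun r => compose r θ) aθ =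
      (hamMatrix (kks b) a').map fun r => compose r θ := by
    have : ∀ Z : Matrix I I (MvPowerSeries I k), (Z.map fun r => compose r θ) =
        (composeHom hθ).mapMatrix Z := fun Z => rfl
    simp only [haθ, this, hamMatrix, map_sub, map_mul]
    rfl
  have h3 : tensorVec b (hamMatrix (kks b) (M * aθ * Mᵀ)) = 0 ↔ IsHamiltonian b h := by
    rw [hamMatrix_conj, kks_conj hg ha, tensorVec_conj_eq_zero_iff hg ha, h2,
      ← compose_tensorVec b hθ, isHamiltonian_iff b hh ha']
    constructor
    · intro h
      have := congrArg (composeHom hχ) h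
      rwa [map_zero, composeHom_apply, compose_compose hθ hχ, funext hgχ, compose_X_right] at this
    · intro h
      rw [h, ← composeHom_apply hθ, map_zero]
  have hprod := (ha'.compose hθ).mul hg ha
  rw [mapMul, isHamiltonian_iff b (by rw [map_mul, constantCoeff_compose hθ, hg, hh, one_mul])
    hprod, ← haθ, ← hM, h1, hamMatrix_add_mul (kks_transpose b), ← h3]
  have h4 := tensorVec_mul_kks_mul_eq_zero b hgham (M * aθ * Mᵀ)
  simp only [map_sub, map_add, hgham, h4, tensorVec_mul_kks_mul_eq_zero' b hgham,
    tensorVec_mul_kks_mul_eq_zero' b h4, zero_add, add_zero, sub_zero]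

omit [CharZero k] in
theorem isHamiltonian_one :
    IsHamiltonian b (1 : MvPowerSeries I (UniversalEnvelopingAlgebra k 𝔤)) := by
  have h : HasLogDeriv b (1 : MvPowerSeries I (UniversalEnvelopingAlgebra k 𝔤)) 0 := fun i => by
    rw [partialDeriv_one, one_mul]; exact (map_zero (vec b)).symm
  rw [isHamiltonian_iff b (map_one _) h, hamMatrix]
  simp

end Hamiltonian

end FormalMaps

end

theorem mainTheorem5 {k 𝔤 I : Type*} [Field k] [CharZero k] [LieRing 𝔤] [LieAlgebra k 𝔤]
    [Fintype I] (b : Module.Basis I k 𝔤) :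
    ∃ _ : Group (FormalMaps.map0 k 𝔤 I),
      (∀ g₁ g₂ : FormalMaps.map0 k 𝔤 I,
        ((g₁ * g₂ : FormalMaps.map0 k 𝔤 I) :
          MvPowerSeries I (UniversalEnvelopingAlgebra k 𝔤)) = FormalMaps.mapMul b g₁ g₂) ∧
      ∃ H : Subgroup (FormalMaps.map0 k 𝔤 I),
        (H : Set (FormalMaps.map0 k 𝔤 I)) = {g | FormalMaps.IsHamiltonian b g.1} := by
  classical
  let _ := FormalMaps.map0Group b
  have hmul : ∀ g₁ g₂ : FormalMaps.map0 k 𝔤 I, ((g₁ * g₂ : FormalMaps.map0 k 𝔤 I) :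
      MvPowerSeries I (UniversalEnvelopingAlgebra k 𝔤)) = FormalMaps.mapMul b g₁ g₂ :=
    fun _ _ => rfl
  have hone : ((1 : FormalMaps.map0 k 𝔤 I) :
      MvPowerSeries I (UniversalEnvelopingAlgebra k 𝔤)) = 1 := rfl
  have hiff : ∀ g h : FormalMaps.map0 k 𝔤 I, FormalMaps.IsHamiltonian b g.1 →
      (FormalMaps.IsHamiltonian b (g * h).1 ↔ FormalMaps.IsHamiltonian b h.1) := by
    intro g h hg
    obtain ⟨hg0, a, ha⟩ := (FormalMaps.mem_map0_iff b).1 g.2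
    obtain ⟨hh0, a', ha'⟩ := (FormalMaps.mem_map0_iff b).1 h.2
    refine FormalMaps.isHamiltonian_mapMul_iff hg0 ha hh0 ha' hg
      (FormalMaps.constantCoeff_coadjointMap (b := b) (g⁻¹).1) fun j => ?_
    -- `g⁻¹ * g = 1`, so the substitution of `g` composed with that of `g⁻¹` is the identity.
    rw [← FormalMaps.coadjointMap_mapMul (FormalMaps.constantCoeff_of_mem_map0 (g⁻¹).2) hg0,
      ← hmul, inv_mul_cancel, hone, FormalMaps.coadjointMap_one]
  refine ⟨inferInstance, hmul, ⟨⟨⟨{g | FormalMaps.IsHamiltonian b g.1}, ?_⟩, ?_⟩, ?_⟩, rfl⟩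
  · exact fun {g h} hg hh => (hiff g h hg).2 hh
  · exact FormalMaps.isHamiltonian_one
  · intro g hg
    refine (hiff g g⁻¹ hg).1 ?_
    rw [mul_inv_cancel]
    exact FormalMaps.isHamiltonian_one
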